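/- Let $K$ be a field and let $X=\mathbb P^1\times\mathbb P^1$ over $K$, with bi-graded coordinate ring $R=K[x_0,x_1;y_0,y_1]$, where the $x_i$ have bi-degree $(1,0)$ and the $y_i$ have bi-degree $(0,1)$. The ideal of a $K$-rational point $P=([a:b],[c:d])$ is $I(P)=(bx_0-ax_1,\ dy_0-cy_1)$, and the radical ideal of a finite set $Z$ of $K$-rational points of $X$ is $I=I(Z)=\bigcap_{P\in Z}I(P)$. For $m\ge 1$ let $I^{(m)}$ be the $m$-th symbolic power of $I$, i.e. the intersection of those components of a primary decomposition of $I^m$ whose radical is contained in an associated prime of $I$. For a bi-homogeneous ideal $J=I^{(m)}$ or $J=I$ let $\alpha^*(J)$ be the least integer $k$ such that $J$ contains a non-zero form of bi-degree $(k,k)$. (i) Suppose that $\alpha^*(I^{(k+1)})=\alpha^*(I^{(k)})+1$ for $k=1,\dots,5$. Then $\alpha^*(I)=1$, and $Z$ is contained in a divisor of bi-degree $(1,1)$, i.e. all points of $Z$ are zeros of some non-zero form of bi-degree $(1,1)$. (ii) Five equalities cannot in general be replaced by four: over every field $K$ there is a finite set $Z$ of $K$-rational points of $X$, with ideal $I=I(Z)$,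 such that $\alpha^*(I^{(k+1)})=\alpha^*(I^{(k)})+1$ for $k=1,\dots,4$, but $\alpha^*(I)=2$ and $Z$ is not contained in any divisor of bi-degree $(1,1)$. -/

import Mathlib

namespace FatPoints

/-- The `m`-th symbolic power `I^(m)` of an ideal `I`: the elements that lie in `I^m R_p` for every
associated prime `p` of `I`. See `symbolicPower_eq_inf` for the description by a
primary decomposition of `I^m`. -/
noncomputable def symbolicPower {R : Type*} [CommRing R] (I : Ideal R) (m : ℕ) : Ideal R :=
  ⨅ p : Submodule.associatedPrimes I,
    haveI : p.1.IsPrime := p.2.1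
    ((I ^ m).map (algebraMap R (Localization.AtPrime p.1))).comap
      (algebraMap R (Localization.AtPrime p.1))

theorem mem_symbolicPower_iff {R : Type*} [CommRing R] (I : Ideal R) (m : ℕ) (f : R) :
    f ∈ symbolicPower I m ↔
      ∀ p ∈ Submodule.associatedPrimes I, ∃ s, s ∉ p ∧ s * f ∈ I ^ m := by
  unfold symbolicPower
  rw [Submodule.mem_iInf]
  constructor
  · intro h p hp
    have : p.IsPrime := hp.1
    have h1 := h ⟨p, hp⟩
    rw [Ideal.mem_comap,
      IsLocalization.algebraMap_mem_map_algebraMap_iff p.primeCompl] at h1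
    obtain ⟨s, hs, hsf⟩ := h1
    exact ⟨s, hs, hsf⟩
  · rintro h ⟨p, hp⟩
    have : p.IsPrime := hp.1
    obtain ⟨s, hs, hsf⟩ := h p hp
    rw [Ideal.mem_comap,
      IsLocalization.algebraMap_mem_map_algebraMap_iff p.primeCompl]
    exact ⟨s, hs, hsf⟩

open Classical in
/-- If `I^m` is the intersection of finitely many primary ideals, then `I^(m)` is the intersection
of those components whose radical is contained in an associated prime of `I`. -/
theorem symbolicPower_eq_inf {R : Type*} [CommRing R] (I : Ideal R) (m : ℕ)
    (t : Finset (Ideal R)) (ht : ∀ q ∈ t, q.IsPrimary) (hI : t.inf id = I ^ m) :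
    symbolicPower I m =
      (t.filter fun q => ∃ p ∈ Submodule.associatedPrimes I, q.radical ≤ p).inf id := by
  ext f
  rw [mem_symbolicPower_iff]
  simp only [Submodule.mem_finsetInf, Finset.mem_filter, id]
  constructor
  · rintro h q ⟨hq, p, hp, hqp⟩
    obtain ⟨s, hs, hsf⟩ := h p hp
    rw [← hI, Submodule.mem_finsetInf] at hsf
    have h1 : s * f ∈ q := hsf q hq
    rw [mul_comm] at h1
    rcases (Ideal.isPrimary_iff.mp (ht q hq)).2 h1 with h2 | h2
    · exact h2
    · exact absurd (hqp h2) hs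
  · intro h p hp
    have : p.IsPrime := hp.1
    have key : ∀ q : Ideal R, ∃ s, s ∉ p ∧ (q ∈ t → s * f ∈ q) := by
      intro q
      by_cases hqp : q.radical ≤ p
      · refine ⟨1, (Ideal.ne_top_iff_one p).mp hp.1.ne_top, fun hq => ?_⟩
        rw [one_mul]
        exact h q ⟨hq, p, hp, hqp⟩
      · have h1 : ¬ q ≤ p := fun h2 => hqp ((Ideal.IsPrime.radical_le_iff hp.1).mpr h2)
        obtain ⟨s, hs, hsp⟩ := SetLike.not_le_iff_exists.mp h1
        exact ⟨s, hsp, fun _ => q.mul_mem_right f hs⟩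
    choose s hs hsf using key
    refine ⟨∏ q ∈ t, s q, ?_, ?_⟩
    · intro hmem
      obtain ⟨q, -, hq⟩ := (Ideal.IsPrime.prod_mem_iff).mp hmem
      exact hs q hq
    · rw [← hI, Submodule.mem_finsetInf]
      intro q hq
      obtain ⟨c, hc⟩ := Finset.dvd_prod_of_mem s hq
      rw [hc, mul_right_comm]
      exact q.mul_mem_right c (hsf q hq)

/-- The bi-homogeneous coordinate ring `K[x₀, x₁; y₀, y₁]` of `ℙ¹ × ℙ¹`. -/
abbrev CoordRing (K : Type*) [Field K] : Type _ := MvPolynomial (Fin 2 ⊕ Fin 2) K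

/-- The bi-grading: `xᵢ` has bi-degree `(1, 0)` and `yᵢ` has bi-degree `(0, 1)`. -/
def biweight : Fin 2 ⊕ Fin 2 → ℕ × ℕ := Sum.elim (fun _ => (1, 0)) (fun _ => (0, 1))

/-- `F` is a bi-homogeneous form of bi-degree `(a, b)`. -/
def IsBihomogeneous {K : Type*} [Field K] (F : CoordRing K) (a b : ℕ) : Prop :=
  MvPolynomial.IsWeightedHomogeneous biweight F (a, b)

/-- The `K`-rational points of `ℙ¹`. -/
abbrev P1 (K : Type*) [Field K] : Type _ := Projectivization K (Fin 2 → K)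

/-- The ideal of the point `([a : b], [c : d])`, generated by `b x₀ - a x₁` and `d y₀ - c y₁`. -/
noncomputable def pointIdeal {K : Type*} [Field K] (P : P1 K × P1 K) : Ideal (CoordRing K) :=
  Ideal.span
    {MvPolynomial.C (P.1.rep 1) * MvPolynomial.X (Sum.inl 0) -
        MvPolynomial.C (P.1.rep 0) * MvPolynomial.X (Sum.inl 1),
      MvPolynomial.C (P.2.rep 1) * MvPolynomial.X (Sum.inr 0) -
        MvPolynomial.C (P.2.rep 0) * MvPolynomial.X (Sum.inr 1)}

/-- The radical bi-homogeneous ideal `I(Z)` of a finite set of points of `ℙ¹ × ℙ¹`. -/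
noncomputable def pointsIdeal {K : Type*} [Field K] (Z : Finset (P1 K × P1 K)) :
    Ideal (CoordRing K) :=
  ⨅ P ∈ Z, pointIdeal P

/-- `α*(J)`: the least `k` such that `J` contains a non-zero form of bi-degree `(k, k)`. -/
noncomputable def alphaStar {K : Type*} [Field K] (J : Ideal (CoordRing K)) : ℕ :=
  sInf {k : ℕ | ∃ F ∈ J, F ≠ 0 ∧ IsBihomogeneous F k k}

/-- `Z` lies on an effective divisor of bi-degree `(a, b)`, i.e. on the zero locus of a non-zero
form of bi-degree `(a, b)`. -/
def LiesOnDivisor {K : Type*} [Field K] (Z : Finset (P1 K × P1 K)) (a b : ℕ) : Prop :=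
  ∃ F : CoordRing K, F ≠ 0 ∧ IsBihomogeneous F a b ∧
    ∀ P ∈ Z, MvPolynomial.eval (Sum.elim P.1.rep P.2.rep) F = 0

end FatPoints

/-!
Multiplicities at points are measured by expanding a form in coordinates adapted to the point
(`ord`). Since the powers of the ideal of a point are primary and the associated primes of `I(Z)`
are the ideals of the points of `Z`, a nonzero form lies in `I(Z)^(m)` if and only if it has
multiplicity at least `m` at every point of `Z` (`mem_symbolicPower_iff_ord`).

The geometric input is the Bézout inequality `sum_ord_mul_ord_le` on `ℙ¹ × ℙ¹`: coprime forms of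
bidegrees `(p, q)` and `(r, s)` satisfy `∑ ord F · ord G ≤ p s + q r`, the sum being over any finite
set of rational points. It is proved over an arbitrary field by counting dimensions of spaces of
forms and of jets. Common components are dealt with by factoring one of the forms; the factors are
again bihomogeneous and multiplicities are additive.

Put `a = α*(I(Z))`. Five equalities give a form `F` of bidegree `(a + 5, a + 5)` with multiplicity
`6` along `Z`.

* If `a ≥ 3`, choose a minimal subset `Y` of `Z` on which no form of bidegree `(a - 1, a - 1)`
  vanishes. It has at least `a²` points, and the forms of bidegrees `(a, a - 1)` and `(a - 1, a)`
  that vanish on `Y` have no common component. Intersecting them with the components of `F` gives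
  `6 a² ≤ 2 a (a + 5)` (`Determines.exists_sum_ord_le`), which is impossible.
* If `a = 2`, then `Z` lies on no curve of bidegree `(1, 1)`, and it does not lie in a grid
  `{x₁, x₂} × {y₁, y₂}`, as otherwise the union of four fibres would give `α*(I^(2)) ≤ 2`. Hence
  `Z` contains four points in one of a few special positions, for each of which a form of bidegree
  `(d, d)` with multiplicity `k` satisfies `6 k ≤ 5 d` (`slope_of_not_on_conic`). This contradicts
  `d = 7`, `k = 6`. In each position the bound follows by removing from the form its components
  among fibres and curves of bidegree `(1, 1)` through three of the points, applying Bézout to the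
  residual form (`exists_residual`), and solving a linear program.

The bound `6 k ≤ 5 d` is attained by the four points `(x₁, y₁), (x₂, y₁), (x₂, y₂), (x₃, y₂)`, which
exist over every field. There `α*(I^(m)) = m + 1` for `m ≤ 5` (`alphaStar_pathPoints`), which shows
that four equalities do not suffice.
-/

open MvPolynomial

namespace FatPoints

/-! ### Weighted expansions of polynomials -/

section Weighted

variable {K σ : Type*} [Field K]

/-- The homomorphism `Xᵢ ↦ Xᵢ t ^ wᵢ`; the coefficient of `t ^ j` in the image of a polynomial is
its component of weight `j`. -/
noncomputable def weightHom (w : σ → ℕ) :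
    MvPolynomial σ K →ₐ[K] Polynomial (MvPolynomial σ K) :=
  aeval fun i => Polynomial.C (X i) * Polynomial.X ^ w i

theorem weightHom_monomial (w : σ → ℕ) (d : σ →₀ ℕ) (c : K) :
    weightHom w (monomial d c) =
      Polynomial.C (monomial d c) * Polynomial.X ^ Finsupp.weight w d := by
  have h1 : (monomial d c : MvPolynomial σ K) = C c * d.prod fun i e => X i ^ e :=
    monomial_eq
  rw [weightHom, aeval_monomial, h1, Finsupp.weight_apply, Finsupp.sum, Finsupp.prod,
    Finsupp.prod, map_mul, map_prod, ← Finset.prod_pow_eq_pow_sum, mul_assoc,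
    ← Finset.prod_mul_distrib]
  congr 1
  refine Finset.prod_congr rfl fun i _ => ?_
  rw [mul_pow, map_pow, ← pow_mul, smul_eq_mul, mul_comm (w i)]

theorem coeff_coeff_weightHom (w : σ → ℕ) (F : MvPolynomial σ K) (j : ℕ) (d : σ →₀ ℕ) :
    coeff d ((weightHom w F).coeff j) = if Finsupp.weight w d = j then coeff d F else 0 := by
  classical
  induction F using MvPolynomial.induction_on' with
  | monomial u a =>
    rw [weightHom_monomial, Polynomial.coeff_C_mul_X_pow, coeff_monomial]
    by_cases h : j = Finsupp.weight w u
    · rw [if_pos h, coeff_monomial]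
      by_cases hu : u = d
      · subst hu; simp [h]
      · simp [hu]
    · rw [if_neg h, coeff_zero]
      by_cases hu : u = d
      · subst hu; rw [if_neg (Ne.symm h)]
      · simp [hu]
  | add p q hp hq =>
    rw [map_add, Polynomial.coeff_add, coeff_add, hp, hq, coeff_add]
    split_ifs <;> simp

theorem weightHom_injective (w : σ → ℕ) :
    Function.Injective (weightHom w : MvPolynomial σ K →ₐ[K] Polynomial (MvPolynomial σ K)) := by
  rw [injective_iff_map_eq_zero]
  intro F hF
  ext d
  have h := coeff_coeff_weightHom w F (Finsupp.weight w d) d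
  rw [hF, if_pos rfl] at h
  simpa using h.symm

theorem weightHom_ne_zero (w : σ → ℕ) {F : MvPolynomial σ K} (hF : F ≠ 0) : weightHom w F ≠ 0 :=
  (map_ne_zero_iff _ (weightHom_injective w)).mpr hF

theorem weightHom_of_isWeightedHomogeneous {w : σ → ℕ} {F : MvPolynomial σ K} {n : ℕ}
    (hF : IsWeightedHomogeneous w F n) :
    weightHom w F = Polynomial.C F * Polynomial.X ^ n := by
  ext j d
  rw [coeff_coeff_weightHom, Polynomial.coeff_C_mul_X_pow]
  by_cases hd : coeff d F = 0
  · rw [hd]; split_ifs <;> simp [hd]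
  · have h1 := hF hd
    rw [h1]
    by_cases h : n = j
    · simp [h]
    · simp [h, Ne.symm h]

/-- A nonzero product that is homogeneous has homogeneous factors: the lowest and the highest
weight occurring in a polynomial are both additive. -/
theorem isWeightedHomogeneous_of_mul {w : σ → ℕ} {F G : MvPolynomial σ K} {n : ℕ}
    (h : IsWeightedHomogeneous w (F * G) n) (h0 : F * G ≠ 0) :
    ∃ a b, a + b = n ∧ IsWeightedHomogeneous w F a ∧ IsWeightedHomogeneous w G b := by
  have hF := weightHom_ne_zero w (left_ne_zero_of_mul h0)
  have hG := weightHom_ne_zero w (right_ne_zero_of_mul h0)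
  have h1 := weightHom_of_isWeightedHomogeneous h
  have hd := Polynomial.natDegree_mul hF hG
  have ht := Polynomial.natTrailingDegree_mul hF hG
  rw [← map_mul, h1] at hd ht
  have hd' : (Polynomial.C (F * G) * Polynomial.X ^ n).natDegree = n :=
    Polynomial.natDegree_C_mul_X_pow n _ h0
  have ht' : (Polynomial.C (F * G) * Polynomial.X ^ n).natTrailingDegree = n := by
    rw [Polynomial.C_mul_X_pow_eq_monomial, Polynomial.natTrailingDegree_monomial h0]
  rw [hd'] at hd
  rw [ht'] at ht
  have key : ∀ H : MvPolynomial σ K, (weightHom w H).natTrailingDegree = (weightHom w H).natDegree →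
      IsWeightedHomogeneous w H (weightHom w H).natDegree := by
    intro H hH d hd
    have h2 := coeff_coeff_weightHom w H (Finsupp.weight w d) d
    rw [if_pos rfl] at h2
    have h3 : (weightHom w H).coeff (Finsupp.weight w d) ≠ 0 := by
      intro h4; rw [h4, coeff_zero] at h2; exact hd h2.symm
    exact le_antisymm (Polynomial.le_natDegree_of_ne_zero h3)
      (hH ▸ Polynomial.natTrailingDegree_le_of_ne_zero h3)
  have l1 := Polynomial.natTrailingDegree_le_natDegree (weightHom w F)
  have l2 := Polynomial.natTrailingDegree_le_natDegree (weightHom w G)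
  exact ⟨_, _, hd.symm, key F (by omega), key G (by omega)⟩

end Weighted

/-! ### Bihomogeneous forms -/

section Forms

variable {K : Type*} [Field K]

theorem weight_biweight (d : Fin 2 ⊕ Fin 2 →₀ ℕ) :
    Finsupp.weight biweight d =
      (d (Sum.inl 0) + d (Sum.inl 1), d (Sum.inr 0) + d (Sum.inr 1)) := by
  rw [Finsupp.weight_apply, Finsupp.sum_fintype _ _ (by simp)]
  simp [biweight, Fintype.sum_sum_type, Prod.ext_iff]

/-- The degree in the `xᵢ`. -/
def xWeight : Fin 2 ⊕ Fin 2 → ℕ := Sum.elim (fun _ => 1) (fun _ => 0)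

/-- The degree in the `yᵢ`. -/
def yWeight : Fin 2 ⊕ Fin 2 → ℕ := Sum.elim (fun _ => 0) (fun _ => 1)

theorem weight_xWeight (d : Fin 2 ⊕ Fin 2 →₀ ℕ) :
    Finsupp.weight xWeight d = d (Sum.inl 0) + d (Sum.inl 1) := by
  rw [Finsupp.weight_apply, Finsupp.sum_fintype _ _ (by simp)]
  simp [xWeight, Fintype.sum_sum_type]

theorem weight_yWeight (d : Fin 2 ⊕ Fin 2 →₀ ℕ) :
    Finsupp.weight yWeight d = d (Sum.inr 0) + d (Sum.inr 1) := by
  rw [Finsupp.weight_apply, Finsupp.sum_fintype _ _ (by simp)]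
  simp [yWeight, Fintype.sum_sum_type]

theorem isBihomogeneous_iff {F : CoordRing K} {a b : ℕ} :
    IsBihomogeneous F a b ↔
      IsWeightedHomogeneous xWeight F a ∧ IsWeightedHomogeneous yWeight F b := by
  simp only [IsBihomogeneous, IsWeightedHomogeneous, weight_biweight, weight_xWeight,
    weight_yWeight, Prod.mk.injEq]
  exact ⟨fun h => ⟨fun d hd => (h hd).1, fun d hd => (h hd).2⟩, fun h d hd => ⟨h.1 hd, h.2 hd⟩⟩

theorem IsBihomogeneous.mul {F G : CoordRing K} {a b c d : ℕ} (hF : IsBihomogeneous F a b)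
    (hG : IsBihomogeneous G c d) : IsBihomogeneous (F * G) (a + c) (b + d) :=
  IsWeightedHomogeneous.mul hF hG

theorem IsBihomogeneous.pow {F : CoordRing K} {a b : ℕ} (hF : IsBihomogeneous F a b) (n : ℕ) :
    IsBihomogeneous (F ^ n) (n * a) (n * b) := by
  have h := IsWeightedHomogeneous.pow hF n
  simpa [IsBihomogeneous] using h

theorem IsBihomogeneous.prod {ι : Type*} (s : Finset ι) (F : ι → CoordRing K) (a b : ι → ℕ)
    (h : ∀ i ∈ s, IsBihomogeneous (F i) (a i) (b i)) :
    IsBihomogeneous (∏ i ∈ s, F i) (∑ i ∈ s, a i) (∑ i ∈ s, b i) := by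
  have h := IsWeightedHomogeneous.prod s F (fun i => (a i, b i)) h
  rwa [show ∑ i ∈ s, (a i, b i) = (∑ i ∈ s, a i, ∑ i ∈ s, b i) by
    ext <;> simp [Prod.fst_sum, Prod.snd_sum]] at h

theorem isBihomogeneous_one : IsBihomogeneous (1 : CoordRing K) 0 0 :=
  isWeightedHomogeneous_one _ _

theorem isBihomogeneous_X_inl (i : Fin 2) :
    IsBihomogeneous (X (Sum.inl i) : CoordRing K) 1 0 :=
  isWeightedHomogeneous_X _ _ _

theorem isBihomogeneous_X_inr (i : Fin 2) :
    IsBihomogeneous (X (Sum.inr i) : CoordRing K) 0 1 :=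
  isWeightedHomogeneous_X _ _ _

theorem IsBihomogeneous.C_mul {F : CoordRing K} {a b : ℕ} (hF : IsBihomogeneous F a b) (c : K) :
    IsBihomogeneous (C c * F) a b :=
  IsWeightedHomogeneous.C_mul hF c

theorem IsBihomogeneous.sub {F G : CoordRing K} {a b : ℕ} (hF : IsBihomogeneous F a b)
    (hG : IsBihomogeneous G a b) : IsBihomogeneous (F - G) a b :=
  IsWeightedHomogeneous.sub hF hG

theorem IsBihomogeneous.degree_unique {F : CoordRing K} {a b c d : ℕ} (h0 : F ≠ 0)
    (h : IsBihomogeneous F a b) (h' : IsBihomogeneous F c d) : a = c ∧ b = d := by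
  simpa using IsWeightedHomogeneous.inj_right h0 h h'

theorem isBihomogeneous_of_mul {F G : CoordRing K} {a b : ℕ} (h : IsBihomogeneous (F * G) a b)
    (h0 : F * G ≠ 0) :
    ∃ a₁ b₁ a₂ b₂, IsBihomogeneous F a₁ b₁ ∧ IsBihomogeneous G a₂ b₂ ∧ a₁ + a₂ = a ∧
      b₁ + b₂ = b := by
  rw [isBihomogeneous_iff] at h
  obtain ⟨a₁, a₂, ha, h1, h2⟩ := isWeightedHomogeneous_of_mul h.1 h0
  obtain ⟨b₁, b₂, hb, h3, h4⟩ := isWeightedHomogeneous_of_mul h.2 h0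
  exact ⟨a₁, b₁, a₂, b₂, isBihomogeneous_iff.mpr ⟨h1, h3⟩, isBihomogeneous_iff.mpr ⟨h2, h4⟩, ha, hb⟩

/-- The cofactor of a divisor of known bidegree. -/
theorem IsBihomogeneous.cofactor {F G : CoordRing K} {a b c d : ℕ} (hF : IsBihomogeneous F a b)
    (h : IsBihomogeneous (F * G) c d) (h0 : F * G ≠ 0) :
    a ≤ c ∧ b ≤ d ∧ IsBihomogeneous G (c - a) (d - b) := by
  obtain ⟨a₁, b₁, a₂, b₂, h1, h2, h3, h4⟩ := isBihomogeneous_of_mul h h0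
  obtain ⟨rfl, rfl⟩ := hF.degree_unique (left_ne_zero_of_mul h0) h1
  subst h3 h4
  simpa using h2

theorem isUnit_of_isBihomogeneous_zero {F : CoordRing K} (h0 : F ≠ 0)
    (h : IsBihomogeneous F 0 0) : IsUnit F := by
  have h1 : F = C (coeff 0 F) := by
    ext d
    rw [coeff_C]
    split_ifs with hd
    · rw [hd]
    · by_contra hc
      apply hd
      have h2 := h hc
      rw [weight_biweight, Prod.mk.injEq] at h2
      ext i
      rcases i with i | i <;> fin_cases i <;> simp <;> omega
  have h2 : coeff 0 F ≠ 0 := by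
    intro h3
    rw [h3, map_zero] at h1
    exact h0 h1
  rw [h1]
  exact (IsUnit.mk0 _ h2).map C

theorem not_isUnit_of_isBihomogeneous {F : CoordRing K} {a b : ℕ} (h : IsBihomogeneous F a b)
    (hab : a + b ≠ 0) : ¬ IsUnit F := by
  intro hu
  obtain ⟨G, hG⟩ := isUnit_iff_exists_inv.mp hu
  have := h.cofactor (G := G) (hG ▸ isBihomogeneous_one) (hG ▸ one_ne_zero)
  omega

end Forms

/-! ### The order of vanishing at a point -/

section Order

variable {K : Type*} [Field K]

theorem exists_complement (v : Fin 2 → K) (hv : v ≠ 0) :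
    ∃ w : Fin 2 → K, v 0 * w 1 - v 1 * w 0 = 1 := by
  by_cases h : v 0 = 0
  · have h1 : v 1 ≠ 0 := by
      intro h1; apply hv; ext i; fin_cases i <;> simp [h, h1]
    exact ⟨![-(v 1)⁻¹, 0], by simp [h1]⟩
  · exact ⟨![0, (v 0)⁻¹], by simp [h]⟩

/-- A vector completing the chosen representative of a point of `ℙ¹` to a basis of determinant
one. -/
noncomputable def complement (p : P1 K) : Fin 2 → K :=
  (exists_complement p.rep p.rep_nonzero).choose

theorem complement_spec (p : P1 K) :
    p.rep 0 * complement p 1 - p.rep 1 * complement p 0 = 1 :=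
  (exists_complement p.rep p.rep_nonzero).choose_spec

/-- The coordinate change that moves `([1 : 0], [1 : 0])` to `P`. -/
noncomputable def frameHom (P : P1 K × P1 K) : CoordRing K →ₐ[K] CoordRing K :=
  aeval (Sum.elim
    (fun i => C (P.1.rep i) * X (Sum.inl 0) + C (complement P.1 i) * X (Sum.inl 1))
    (fun i => C (P.2.rep i) * X (Sum.inr 0) + C (complement P.2 i) * X (Sum.inr 1)))

/-- The inverse of `frameHom P`. -/
noncomputable def frameInv (P : P1 K × P1 K) : CoordRing K →ₐ[K] CoordRing K :=
  aeval (Sum.elim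
    (![C (complement P.1 1) * X (Sum.inl 0) - C (complement P.1 0) * X (Sum.inl 1),
       C (P.1.rep 0) * X (Sum.inl 1) - C (P.1.rep 1) * X (Sum.inl 0)])
    (![C (complement P.2 1) * X (Sum.inr 0) - C (complement P.2 0) * X (Sum.inr 1),
       C (P.2.rep 0) * X (Sum.inr 1) - C (P.2.rep 1) * X (Sum.inr 0)]))

theorem C_complement_spec (p : P1 K) :
    (C (p.rep 0) * C (complement p 1) - C (p.rep 1) * C (complement p 0) : CoordRing K) = 1 := by
  rw [← C_mul, ← C_mul, ← C_sub, complement_spec, C_1]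

/-- The coordinate change that moves `([1 : 0], [1 : 0])` to `P`, as an automorphism. -/
noncomputable def frame (P : P1 K × P1 K) : CoordRing K ≃ₐ[K] CoordRing K :=
  AlgEquiv.ofAlgHom (frameHom P) (frameInv P)
    (by
      apply MvPolynomial.algHom_ext
      have h1 := C_complement_spec P.1
      have h2 := C_complement_spec P.2
      rintro (i | i) <;> fin_cases i <;> simp [frameHom, frameInv, algebraMap_eq]
      · linear_combination X (Sum.inl 0) * h1
      · linear_combination X (Sum.inl 1) * h1
      · linear_combination X (Sum.inr 0) * h2
      · linear_combination X (Sum.inr 1) * h2)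
    (by
      apply MvPolynomial.algHom_ext
      have h1 := C_complement_spec P.1
      have h2 := C_complement_spec P.2
      rintro (i | i) <;> fin_cases i <;> simp [frameHom, frameInv, algebraMap_eq]
      · linear_combination X (Sum.inl 0) * h1
      · linear_combination X (Sum.inl 1) * h1
      · linear_combination X (Sum.inr 0) * h2
      · linear_combination X (Sum.inr 1) * h2)

theorem frame_X_inl (P : P1 K × P1 K) (i : Fin 2) :
    frame P (X (Sum.inl i)) =
      C (P.1.rep i) * X (Sum.inl 0) + C (complement P.1 i) * X (Sum.inl 1) := by
  simp [frame, frameHom]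

theorem frame_X_inr (P : P1 K × P1 K) (i : Fin 2) :
    frame P (X (Sum.inr i)) =
      C (P.2.rep i) * X (Sum.inr 0) + C (complement P.2 i) * X (Sum.inr 1) := by
  simp [frame, frameHom]

theorem frame_C (P : P1 K × P1 K) (c : K) : frame P (C c) = C c := by
  rw [← algebraMap_eq, AlgEquiv.commutes]

theorem frame_ne_zero (P : P1 K × P1 K) {F : CoordRing K} (hF : F ≠ 0) : frame P F ≠ 0 :=
  (map_ne_zero_iff _ (frame P).injective).mpr hF

theorem isBihomogeneous_frame_monomial (P : P1 K × P1 K) (d : Fin 2 ⊕ Fin 2 →₀ ℕ) (c : K) :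
    IsBihomogeneous (frame P (monomial d c)) (Finsupp.weight biweight d).1
      (Finsupp.weight biweight d).2 := by
  rw [monomial_eq, Finsupp.prod_fintype _ _ (by simp), map_mul, frame_C, map_prod,
    weight_biweight]
  refine IsBihomogeneous.C_mul ?_ c
  rw [Fintype.prod_sum_type]
  simp only [Fin.prod_univ_two, map_pow]
  have hx : ∀ i, IsBihomogeneous (frame P (X (Sum.inl i))) 1 0 := fun i => by
    rw [frame_X_inl]
    exact IsWeightedHomogeneous.add ((isBihomogeneous_X_inl 0).C_mul _)
      ((isBihomogeneous_X_inl 1).C_mul _)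
  have hy : ∀ i, IsBihomogeneous (frame P (X (Sum.inr i))) 0 1 := fun i => by
    rw [frame_X_inr]
    exact IsWeightedHomogeneous.add ((isBihomogeneous_X_inr 0).C_mul _)
      ((isBihomogeneous_X_inr 1).C_mul _)
  have h := (((hx 0).pow (d (Sum.inl 0))).mul ((hx 1).pow (d (Sum.inl 1)))).mul
    (((hy 0).pow (d (Sum.inr 0))).mul ((hy 1).pow (d (Sum.inr 1))))
  simpa using h

theorem IsBihomogeneous.map_frame {F : CoordRing K} {a b : ℕ} (hF : IsBihomogeneous F a b)
    (P : P1 K × P1 K) : IsBihomogeneous (frame P F) a b := by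
  rw [F.as_sum, map_sum]
  refine IsWeightedHomogeneous.sum _ _ _ fun d hd => ?_
  have h := isBihomogeneous_frame_monomial P d (coeff d F)
  rwa [hF (mem_support_iff.mp hd)] at h

/-- The weight measuring the order of vanishing at `([1 : 0], [1 : 0])`. -/
def originWeight : Fin 2 ⊕ Fin 2 → ℕ := Sum.elim ![0, 1] ![0, 1]

theorem weight_originWeight (d : Fin 2 ⊕ Fin 2 →₀ ℕ) :
    Finsupp.weight originWeight d = d (Sum.inl 1) + d (Sum.inr 1) := by
  rw [Finsupp.weight_apply, Finsupp.sum_fintype _ _ (by simp)]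
  simp [originWeight, Fintype.sum_sum_type]

/-- The expansion of a polynomial around `P`: the coefficient of `t ^ j` collects the terms that
are of degree `j` in local coordinates at `P`. -/
noncomputable def expansion (P : P1 K × P1 K) : CoordRing K →ₐ[K] Polynomial (CoordRing K) :=
  (weightHom originWeight).comp (frame P).toAlgHom

theorem expansion_apply (P : P1 K × P1 K) (F : CoordRing K) :
    expansion P F = weightHom originWeight (frame P F) := rfl

theorem expansion_ne_zero (P : P1 K × P1 K) {F : CoordRing K} (hF : F ≠ 0) : expansion P F ≠ 0 := by
  rw [expansion_apply]
  exact weightHom_ne_zero _ (frame_ne_zero P hF)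

/-- The multiplicity of `F` at `P`, that is, the order of `F` with respect to the powers of
`pointIdeal P`. By convention it is `0` for `F = 0`. -/
noncomputable def ord (P : P1 K × P1 K) (F : CoordRing K) : ℕ := (expansion P F).natTrailingDegree

theorem ord_mul (P : P1 K × P1 K) {F G : CoordRing K} (hF : F ≠ 0) (hG : G ≠ 0) :
    ord P (F * G) = ord P F + ord P G := by
  rw [ord, map_mul, Polynomial.natTrailingDegree_mul (expansion_ne_zero P hF)
    (expansion_ne_zero P hG)]
  rfl

theorem ord_one (P : P1 K × P1 K) : ord P (1 : CoordRing K) = 0 := by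
  rw [ord, map_one, ← Polynomial.C_1, Polynomial.natTrailingDegree_C]

theorem coeff_frame_eq_zero (P : P1 K × P1 K) {F : CoordRing K} {d : Fin 2 ⊕ Fin 2 →₀ ℕ}
    (hd : d (Sum.inl 1) + d (Sum.inr 1) < ord P F) : coeff d (frame P F) = 0 := by
  have h := coeff_coeff_weightHom originWeight (frame P F) (Finsupp.weight originWeight d) d
  rw [if_pos rfl, weight_originWeight, ← expansion_apply,
    Polynomial.coeff_eq_zero_of_lt_natTrailingDegree hd, coeff_zero] at h
  exact h.symm

theorem le_ord (P : P1 K × P1 K) {F : CoordRing K} (hF : F ≠ 0) {k : ℕ}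
    (h : ∀ d : Fin 2 ⊕ Fin 2 →₀ ℕ, d (Sum.inl 1) + d (Sum.inr 1) < k →
      coeff d (frame P F) = 0) : k ≤ ord P F := by
  refine Polynomial.le_natTrailingDegree (expansion_ne_zero P hF) fun j hj => ?_
  ext d
  rw [expansion_apply, coeff_coeff_weightHom, coeff_zero]
  split_ifs with hd
  · rw [weight_originWeight] at hd
    exact h d (hd ▸ hj)
  · rfl

theorem le_ord_of_X_pow_dvd (P : P1 K × P1 K) {F : CoordRing K} (hF : F ≠ 0) {k : ℕ}
    (h : Polynomial.X ^ k ∣ expansion P F) : k ≤ ord P F :=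
  Polynomial.le_natTrailingDegree (expansion_ne_zero P hF) (Polynomial.X_pow_dvd_iff.mp h)

/-! ### Fibres and the ideal of a point -/

/-- The form `b x₀ - a x₁` of the fibre over `[a : b]` of the first projection. -/
noncomputable def xFiber (p : P1 K) : CoordRing K :=
  C (p.rep 1) * X (Sum.inl 0) - C (p.rep 0) * X (Sum.inl 1)

/-- The form `d y₀ - c y₁` of the fibre over `[c : d]` of the second projection. -/
noncomputable def yFiber (q : P1 K) : CoordRing K :=
  C (q.rep 1) * X (Sum.inr 0) - C (q.rep 0) * X (Sum.inr 1)

theorem isBihomogeneous_xFiber (p : P1 K) : IsBihomogeneous (xFiber p) 1 0 :=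
  ((isBihomogeneous_X_inl 0).C_mul _).sub ((isBihomogeneous_X_inl 1).C_mul _)

theorem isBihomogeneous_yFiber (q : P1 K) : IsBihomogeneous (yFiber q) 0 1 :=
  ((isBihomogeneous_X_inr 0).C_mul _).sub ((isBihomogeneous_X_inr 1).C_mul _)

theorem frame_xFiber (P : P1 K × P1 K) : frame P (xFiber P.1) = -X (Sum.inl 1) := by
  rw [xFiber, map_sub, map_mul, map_mul, frame_C, frame_C, frame_X_inl, frame_X_inl]
  linear_combination -X (Sum.inl 1) * C_complement_spec P.1

theorem frame_yFiber (P : P1 K × P1 K) : frame P (yFiber P.2) = -X (Sum.inr 1) := by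
  rw [yFiber, map_sub, map_mul, map_mul, frame_C, frame_C, frame_X_inr, frame_X_inr]
  linear_combination -X (Sum.inr 1) * C_complement_spec P.2

theorem prime_xFiber (p : P1 K) : Prime (xFiber p) := by
  rw [← MulEquiv.prime_iff (frame (p, p)).toMulEquiv]
  change Prime (frame (p, p) (xFiber p))
  rw [frame_xFiber (p, p)]
  exact X_prime.neg

theorem prime_yFiber (p : P1 K) : Prime (yFiber p) := by
  rw [← MulEquiv.prime_iff (frame (p, p)).toMulEquiv]
  change Prime (frame (p, p) (yFiber p))
  rw [frame_yFiber (p, p)]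
  exact X_prime.neg

theorem xFiber_ne_zero (p : P1 K) : xFiber p ≠ 0 := (prime_xFiber p).ne_zero

theorem yFiber_ne_zero (p : P1 K) : yFiber p ≠ 0 := (prime_yFiber p).ne_zero

theorem pointIdeal_eq (P : P1 K × P1 K) :
    pointIdeal P = Ideal.span {xFiber P.1, yFiber P.2} := rfl

theorem xFiber_mem (P : P1 K × P1 K) : xFiber P.1 ∈ pointIdeal P :=
  Ideal.subset_span (by simp [xFiber])

theorem yFiber_mem (P : P1 K × P1 K) : yFiber P.2 ∈ pointIdeal P :=
  Ideal.subset_span (by simp [yFiber])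

theorem X_dvd_expansion_xFiber (P : P1 K × P1 K) :
    Polynomial.X ∣ expansion P (xFiber P.1) := by
  have h : expansion P (-xFiber P.1) = Polynomial.C (X (Sum.inl 1)) * Polynomial.X := by
    rw [expansion_apply, map_neg, frame_xFiber, neg_neg, weightHom, aeval_X]
    simp [originWeight]
  have h2 : Polynomial.X ∣ expansion P (-xFiber P.1) := h ▸ dvd_mul_left _ _
  rw [show xFiber P.1 = C (-1) * -xFiber P.1 by simp, map_mul]
  exact dvd_mul_of_dvd_right h2 _

theorem X_dvd_expansion_yFiber (P : P1 K × P1 K) :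
    Polynomial.X ∣ expansion P (yFiber P.2) := by
  have h : expansion P (-yFiber P.2) = Polynomial.C (X (Sum.inr 1)) * Polynomial.X := by
    rw [expansion_apply, map_neg, frame_yFiber, neg_neg, weightHom, aeval_X]
    simp [originWeight]
  have h2 : Polynomial.X ∣ expansion P (-yFiber P.2) := h ▸ dvd_mul_left _ _
  rw [show yFiber P.2 = C (-1) * -yFiber P.2 by simp, map_mul]
  exact dvd_mul_of_dvd_right h2 _

theorem X_pow_dvd_expansion (P : P1 K × P1 K) {F : CoordRing K} {k : ℕ}
    (hF : F ∈ pointIdeal P ^ k) : Polynomial.X ^ k ∣ expansion P F := by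
  have h1 : (pointIdeal P).map (expansion P) ≤ Ideal.span {(Polynomial.X : Polynomial (CoordRing K))} := by
    rw [pointIdeal_eq, Ideal.map_span, Ideal.span_le]
    rintro _ ⟨F, hF, rfl⟩
    rcases hF with rfl | rfl
    · exact Ideal.mem_span_singleton.mpr (X_dvd_expansion_xFiber P)
    · exact Ideal.mem_span_singleton.mpr (X_dvd_expansion_yFiber P)
  have h2 := Ideal.mem_map_of_mem (expansion P) hF
  rw [Ideal.map_pow] at h2
  have h3 := Ideal.pow_right_mono h1 k h2
  rwa [Ideal.span_singleton_pow, Ideal.mem_span_singleton] at h3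

/-- In coordinates at `P` the ideal of `P` is generated by `x₁` and `y₁`, so its powers are spanned
by the monomials that they contain. -/
theorem mem_pointIdeal_pow_of_coeff (P : P1 K × P1 K) {F : CoordRing K} {k : ℕ}
    (h : ∀ d : Fin 2 ⊕ Fin 2 →₀ ℕ, d (Sum.inl 1) + d (Sum.inr 1) < k →
      coeff d (frame P F) = 0) : F ∈ pointIdeal P ^ k := by
  have hx : (frame P).symm (X (Sum.inl 1)) ∈ pointIdeal P := by
    rw [show X (Sum.inl 1) = frame P (-xFiber P.1) by rw [map_neg, frame_xFiber, neg_neg],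
      AlgEquiv.symm_apply_apply]
    exact neg_mem (xFiber_mem P)
  have hy : (frame P).symm (X (Sum.inr 1)) ∈ pointIdeal P := by
    rw [show X (Sum.inr 1) = frame P (-yFiber P.2) by rw [map_neg, frame_yFiber, neg_neg],
      AlgEquiv.symm_apply_apply]
    exact neg_mem (yFiber_mem P)
  rw [← (frame P).symm_apply_apply F, (frame P F).as_sum, map_sum]
  refine Ideal.sum_mem _ fun d hd => ?_
  have hdk : k ≤ d (Sum.inl 1) + d (Sum.inr 1) := by
    by_contra hlt
    exact mem_support_iff.mp hd (h d (not_le.mp hlt))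
  rw [monomial_eq, Finsupp.prod_fintype _ _ (by simp), Fintype.prod_sum_type]
  simp only [Fin.prod_univ_two, map_mul, map_pow]
  have h2 : (frame P).symm (X (Sum.inl 1)) ^ d (Sum.inl 1) *
      (frame P).symm (X (Sum.inr 1)) ^ d (Sum.inr 1) ∈ pointIdeal P ^ k := by
    refine Ideal.pow_le_pow_right hdk ?_
    rw [pow_add]
    exact Ideal.mul_mem_mul (Ideal.pow_mem_pow hx _) (Ideal.pow_mem_pow hy _)
  refine Ideal.mem_of_dvd _ ?_ h2
  exact ⟨(frame P).symm (C (coeff d (frame P F))) * (frame P).symm (X (Sum.inl 0)) ^ d (Sum.inl 0) *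
    (frame P).symm (X (Sum.inr 0)) ^ d (Sum.inr 0), by ring⟩

theorem mem_pointIdeal_pow_iff_dvd (P : P1 K × P1 K) {F : CoordRing K} {k : ℕ} :
    F ∈ pointIdeal P ^ k ↔ Polynomial.X ^ k ∣ expansion P F := by
  refine ⟨X_pow_dvd_expansion P, fun h => mem_pointIdeal_pow_of_coeff P fun d hd => ?_⟩
  have h1 := coeff_coeff_weightHom originWeight (frame P F)
    (Finsupp.weight originWeight d) d
  rw [if_pos rfl, weight_originWeight, ← expansion_apply, Polynomial.X_pow_dvd_iff.mp h _ hd,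
    coeff_zero] at h1
  exact h1.symm

theorem mem_pointIdeal_iff_dvd (P : P1 K × P1 K) {F : CoordRing K} :
    F ∈ pointIdeal P ↔ Polynomial.X ∣ expansion P F := by
  simpa using mem_pointIdeal_pow_iff_dvd P (F := F) (k := 1)

theorem mem_pointIdeal_pow_iff (P : P1 K × P1 K) {F : CoordRing K} (hF : F ≠ 0) {k : ℕ} :
    F ∈ pointIdeal P ^ k ↔ k ≤ ord P F :=
  ⟨fun h => le_ord_of_X_pow_dvd P hF (X_pow_dvd_expansion P h), fun h =>
    mem_pointIdeal_pow_of_coeff P fun _ hd => coeff_frame_eq_zero P (hd.trans_le h)⟩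

theorem isPrime_pointIdeal (P : P1 K × P1 K) : (pointIdeal P).IsPrime := by
  have h : pointIdeal P = (Ideal.span {(Polynomial.X : Polynomial (CoordRing K))}).comap
      (expansion P) := by
    ext F
    rw [Ideal.mem_comap, Ideal.mem_span_singleton, mem_pointIdeal_iff_dvd]
  rw [h]
  have := (Ideal.span_singleton_prime Polynomial.X_ne_zero).mpr
    (Polynomial.prime_X (R := CoordRing K))
  exact Ideal.comap_isPrime _ _

/-- The powers of the ideal of a point are primary. -/
theorem mem_pointIdeal_pow_of_mul_mem (P : P1 K × P1 K) {s F : CoordRing K} {k : ℕ}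
    (hs : s ∉ pointIdeal P) (h : s * F ∈ pointIdeal P ^ k) : F ∈ pointIdeal P ^ k := by
  rw [mem_pointIdeal_pow_iff_dvd, map_mul] at h
  rw [mem_pointIdeal_iff_dvd] at hs
  rw [mem_pointIdeal_pow_iff_dvd]
  exact Polynomial.prime_X.pow_dvd_of_dvd_mul_left k hs h

/-- A form lies in the ideal of `P` if and only if it vanishes at the chosen representative. -/
theorem IsBihomogeneous.mem_pointIdeal_iff (P : P1 K × P1 K) {F : CoordRing K} {a b : ℕ}
    (hF : IsBihomogeneous F a b) :
    F ∈ pointIdeal P ↔ eval (Sum.elim P.1.rep P.2.rep) F = 0 := by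
  have key : eval (Sum.elim P.1.rep P.2.rep) F =
      eval (Sum.elim ![1, 0] ![1, 0]) (frame P F) := by
    have h : (aeval (Sum.elim P.1.rep P.2.rep) : CoordRing K →ₐ[K] K) =
        (aeval (Sum.elim ![1, 0] ![1, 0])).comp (frame P).toAlgHom := by
      apply MvPolynomial.algHom_ext
      rintro (i | i)
      · simp [frame_X_inl]
      · simp [frame_X_inr]
    exact congrArg (fun f => f F) h
  have key2 : eval (Sum.elim ![1, 0] ![1, 0]) (frame P F) =
      coeff (Finsupp.single (Sum.inl 0) a + Finsupp.single (Sum.inr 0) b) (frame P F) := by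
    rw [eval_eq', Finset.sum_eq_single
      (Finsupp.single (Sum.inl 0) a + Finsupp.single (Sum.inr 0) b)]
    · simp [Fintype.prod_sum_type]
    · intro d hd hne
      have h1 := hF.map_frame P (mem_support_iff.mp hd)
      rw [weight_biweight, Prod.mk.injEq] at h1
      by_cases h2 : d (Sum.inl 1) = 0 ∧ d (Sum.inr 1) = 0
      · exfalso
        apply hne
        ext i
        rcases i with i | i <;> fin_cases i <;> simp <;> omega
      · rw [not_and_or] at h2
        rcases h2 with h2 | h2 <;> simp [Fintype.prod_sum_type, h2]
    · intro h
      rw [notMem_support_iff.mp h, zero_mul]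
  rw [key, key2]
  constructor
  · intro h
    have h1 := (mem_pointIdeal_iff_dvd P).mp h
    have h3 := coeff_coeff_weightHom originWeight (frame P F) 0
      (Finsupp.single (Sum.inl 0) a + Finsupp.single (Sum.inr 0) b)
    rw [← expansion_apply, Polynomial.X_dvd_iff.mp h1, weight_originWeight] at h3
    simpa using h3.symm
  · intro h
    have := mem_pointIdeal_pow_of_coeff P (F := F) (k := 1) fun d hd => by
      by_contra hne
      have h1 := hF.map_frame P hne
      rw [weight_biweight, Prod.mk.injEq] at h1
      apply hne
      rw [← h]
      congr 1
      ext i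
      rcases i with i | i <;> fin_cases i <;> simp <;> omega
    simpa using this

end Order

/-! ### Symbolic powers of the ideal of a finite set of points -/

section Symbolic

variable {K : Type*} [Field K]

theorem eq_of_det_eq_zero {p q : P1 K} (h : p.rep 1 * q.rep 0 - p.rep 0 * q.rep 1 = 0) :
    p = q := by
  rw [← p.mk_rep, ← q.mk_rep, Projectivization.mk_eq_mk_iff']
  by_cases h0 : q.rep 0 = 0
  · have h1 : q.rep 1 ≠ 0 := by
      intro h1; apply q.rep_nonzero; ext i; fin_cases i <;> simp [h0, h1]
    have h2 : p.rep 0 = 0 := by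
      rw [h0, mul_zero, zero_sub, neg_eq_zero] at h
      exact (mul_eq_zero.mp h).resolve_right h1
    refine ⟨p.rep 1 / q.rep 1, ?_⟩
    ext i; fin_cases i
    · simp [h0, h2]
    · simp [h1]
  · refine ⟨p.rep 0 / q.rep 0, ?_⟩
    ext i; fin_cases i
    · simp [h0]
    · simp; field_simp; linear_combination -h

theorem xFiber_mem_iff {p : P1 K} {Q : P1 K × P1 K} : xFiber p ∈ pointIdeal Q ↔ p = Q.1 := by
  rw [(isBihomogeneous_xFiber p).mem_pointIdeal_iff]
  simp only [xFiber, map_sub, map_mul, eval_C, eval_X, Sum.elim_inl]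
  exact ⟨eq_of_det_eq_zero, fun h => by rw [h]; ring⟩

theorem yFiber_mem_iff {q : P1 K} {Q : P1 K × P1 K} : yFiber q ∈ pointIdeal Q ↔ q = Q.2 := by
  rw [(isBihomogeneous_yFiber q).mem_pointIdeal_iff]
  simp only [yFiber, map_sub, map_mul, eval_C, eval_X, Sum.elim_inr]
  exact ⟨eq_of_det_eq_zero, fun h => by rw [h]; ring⟩

/-- A fibre through `P` that avoids `Q`. -/
theorem exists_separating_fiber {P Q : P1 K × P1 K} (h : P ≠ Q) :
    ∃ s a b, IsBihomogeneous s a b ∧ a ≤ 1 ∧ b ≤ 1 ∧ s ∈ pointIdeal P ∧ s ∉ pointIdeal Q := by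
  by_cases h1 : P.1 = Q.1
  · exact ⟨yFiber P.2, 0, 1, isBihomogeneous_yFiber _, by simp, by simp, yFiber_mem P,
      fun h2 => h (Prod.ext h1 (yFiber_mem_iff.mp h2))⟩
  · exact ⟨xFiber P.1, 1, 0, isBihomogeneous_xFiber _, by simp, by simp, xFiber_mem P,
      fun h2 => h1 (xFiber_mem_iff.mp h2)⟩

theorem mem_pointsIdeal {Z : Finset (P1 K × P1 K)} {F : CoordRing K} :
    F ∈ pointsIdeal Z ↔ ∀ P ∈ Z, F ∈ pointIdeal P := by
  simp only [pointsIdeal, Submodule.mem_iInf]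

open Classical in
/-- A product of fibres that passes through the other points of `Z` but avoids `Q`. -/
theorem exists_separator (Z : Finset (P1 K × P1 K)) (Q : P1 K × P1 K) :
    ∃ s, s ∉ pointIdeal Q ∧ ∀ P ∈ Z, P ≠ Q → s ∈ pointIdeal P := by
  have := isPrime_pointIdeal Q
  choose! s a b _ _ _ hs hs' using fun P (h : P ≠ Q) => exists_separating_fiber h
  refine ⟨∏ P ∈ Z.erase Q, s P, fun hmem => ?_, fun P hP hPQ => ?_⟩
  · obtain ⟨P, hP, hPs⟩ := Ideal.IsPrime.prod_mem_iff.mp hmem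
    exact hs' P (Finset.ne_of_mem_erase hP) hPs
  · exact Ideal.mem_of_dvd _ (Finset.dvd_prod_of_mem s (Finset.mem_erase.mpr ⟨hPQ, hP⟩)) (hs P hPQ)

theorem pointIdeal_mem_associatedPrimes {Z : Finset (P1 K × P1 K)} {P : P1 K × P1 K} (hP : P ∈ Z) :
    pointIdeal P ∈ Submodule.associatedPrimes (pointsIdeal Z) := by
  have hprime := isPrime_pointIdeal P
  refine Submodule.isAssociatedPrime_iff.mpr ⟨hprime, ?_⟩
  obtain ⟨s, hs, hs'⟩ := exists_separator Z P
  refine ⟨s, ?_⟩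
  ext F
  rw [Submodule.mem_colon_singleton, smul_eq_mul, mem_pointsIdeal]
  constructor
  · intro hF Q hQ
    by_cases h : Q = P
    · rw [h]; exact Ideal.mul_mem_right _ _ hF
    · exact Ideal.mul_mem_left _ _ (hs' Q hQ h)
  · intro h
    exact (hprime.mem_or_mem (h P hP)).resolve_right hs

theorem exists_eq_of_mem_associatedPrimes {Z : Finset (P1 K × P1 K)} {p : Ideal (CoordRing K)}
    (hp : p ∈ Submodule.associatedPrimes (pointsIdeal Z)) : ∃ P ∈ Z, p = pointIdeal P := by
  classical
  obtain ⟨hprime, s, hs⟩ := Submodule.isAssociatedPrime_iff.mp hp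
  have hle : ∀ P ∈ Z, s ∉ pointIdeal P → p ≤ pointIdeal P := by
    intro P hP hsP F hF
    have := isPrime_pointIdeal P
    rw [hs, Submodule.mem_colon_singleton, smul_eq_mul, mem_pointsIdeal] at hF
    exact (this.mem_or_mem (hF P hP)).resolve_right hsP
  have h1 : (Z.filter fun P => s ∉ pointIdeal P).inf pointIdeal ≤ p := by
    intro F hF
    rw [Submodule.mem_finsetInf] at hF
    rw [hs, Submodule.mem_colon_singleton, smul_eq_mul, mem_pointsIdeal]
    intro P hP
    by_cases h : s ∈ pointIdeal P
    · exact Ideal.mul_mem_left _ _ h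
    · exact Ideal.mul_mem_right _ _ (hF P (Finset.mem_filter.mpr ⟨hP, h⟩))
  obtain ⟨P, hP, hPp⟩ := (Ideal.IsPrime.inf_le' hprime).mp h1
  obtain ⟨hPZ, hsP⟩ := Finset.mem_filter.mp hP
  exact ⟨P, hPZ, le_antisymm (hle P hPZ hsP) hPp⟩

/-- The symbolic powers of a radical ideal of points are intersections of powers of the ideals of
the points. -/
theorem mem_symbolicPower_pointsIdeal {Z : Finset (P1 K × P1 K)} {m : ℕ} {F : CoordRing K} :
    F ∈ symbolicPower (pointsIdeal Z) m ↔ ∀ P ∈ Z, F ∈ pointIdeal P ^ m := by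
  classical
  rw [mem_symbolicPower_iff]
  constructor
  · intro h P hP
    obtain ⟨s, hs, hsF⟩ := h _ (pointIdeal_mem_associatedPrimes hP)
    refine mem_pointIdeal_pow_of_mul_mem P hs (Ideal.pow_right_mono ?_ m hsF)
    exact fun G hG => mem_pointsIdeal.mp hG P hP
  · intro h p hp
    obtain ⟨P, hP, rfl⟩ := exists_eq_of_mem_associatedPrimes hp
    have hprime := isPrime_pointIdeal P
    obtain ⟨s, hs, hs'⟩ := exists_separator Z P
    refine ⟨s ^ m, fun h1 => hs (hprime.mem_of_pow_mem m h1), ?_⟩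
    have h2 : Ideal.span {s} * pointIdeal P ≤ pointsIdeal Z := by
      rw [Ideal.span_singleton_mul_le_iff]
      intro G hG
      rw [mem_pointsIdeal]
      intro Q hQ
      by_cases hQP : Q = P
      · rw [hQP]; exact Ideal.mul_mem_left _ _ hG
      · exact Ideal.mul_mem_right _ _ (hs' Q hQ hQP)
    refine Ideal.pow_right_mono h2 m ?_
    rw [mul_pow, Ideal.span_singleton_pow]
    exact Ideal.mul_mem_mul (Ideal.mem_span_singleton_self _) (h P hP)

theorem symbolicPower_pointsIdeal_one (Z : Finset (P1 K × P1 K)) :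
    symbolicPower (pointsIdeal Z) 1 = pointsIdeal Z := by
  ext F
  simp only [mem_symbolicPower_pointsIdeal, mem_pointsIdeal, pow_one]

theorem mem_symbolicPower_iff_ord {Z : Finset (P1 K × P1 K)} {m : ℕ} {F : CoordRing K}
    (hF : F ≠ 0) : F ∈ symbolicPower (pointsIdeal Z) m ↔ ∀ P ∈ Z, m ≤ ord P F := by
  rw [mem_symbolicPower_pointsIdeal]
  exact forall₂_congr fun P _ => mem_pointIdeal_pow_iff P hF

theorem mem_pointIdeal_iff_ord (P : P1 K × P1 K) {F : CoordRing K} (hF : F ≠ 0) :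
    F ∈ pointIdeal P ↔ 1 ≤ ord P F := by
  simpa using mem_pointIdeal_pow_iff P hF (k := 1)

end Symbolic

/-! ### Dimensions of spaces of forms -/

section Dimension

variable {K : Type*} [Field K]

/-- The space of forms of bidegree `(a, b)`. -/
noncomputable def forms (K : Type*) [Field K] (a b : ℕ) : Submodule K (CoordRing K) :=
  weightedHomogeneousSubmodule K biweight (a, b)

theorem mem_forms {a b : ℕ} {F : CoordRing K} : F ∈ forms K a b ↔ IsBihomogeneous F a b := Iff.rfl

/-- The exponent of `x₀ ^ (a - i) x₁ ^ i y₀ ^ (b - j) y₁ ^ j`. -/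
noncomputable def expo (a b i j : ℕ) : Fin 2 ⊕ Fin 2 →₀ ℕ :=
  Finsupp.equivFunOnFinite.symm (Sum.elim ![a - i, i] ![b - j, j])

@[simp] theorem expo_inl_zero (a b i j : ℕ) : expo a b i j (Sum.inl 0) = a - i := rfl
@[simp] theorem expo_inl_one (a b i j : ℕ) : expo a b i j (Sum.inl 1) = i := rfl
@[simp] theorem expo_inr_zero (a b i j : ℕ) : expo a b i j (Sum.inr 0) = b - j := rfl
@[simp] theorem expo_inr_one (a b i j : ℕ) : expo a b i j (Sum.inr 1) = j := rfl

theorem eq_expo {a b : ℕ} {d : Fin 2 ⊕ Fin 2 →₀ ℕ}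
    (hd : Finsupp.weight biweight d = (a, b)) :
    d = expo a b (d (Sum.inl 1)) (d (Sum.inr 1)) := by
  rw [weight_biweight, Prod.mk.injEq] at hd
  ext i
  rcases i with i | i <;> fin_cases i <;> simp <;> omega

theorem weight_expo {a b i j : ℕ} (hi : i ≤ a) (hj : j ≤ b) :
    Finsupp.weight biweight (expo a b i j) = (a, b) := by
  rw [weight_biweight]
  simp [hi, hj]

/-- A form is determined by its coefficients. -/
noncomputable def formsCoeff (a b : ℕ) : forms K a b →ₗ[K] (Fin (a + 1) × Fin (b + 1) → K) :=
  LinearMap.pi fun x => (lcoeff K (expo a b x.1 x.2)).comp (forms K a b).subtype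

theorem formsCoeff_apply (a b : ℕ) (F : forms K a b) (x : Fin (a + 1) × Fin (b + 1)) :
    formsCoeff a b F x = coeff (expo a b x.1 x.2) F.1 := rfl

theorem formsCoeff_bijective (a b : ℕ) :
    Function.Bijective (formsCoeff a b : forms K a b →ₗ[K] _) := by
  classical
  constructor
  · rw [injective_iff_map_eq_zero]
    rintro ⟨F, hF⟩ h
    ext d
    by_contra hne
    have hd := hF hne
    have h1 := hd
    rw [weight_biweight, Prod.mk.injEq] at h1
    apply hne
    rw [eq_expo hd]
    exact congrFun h (⟨d (Sum.inl 1), by omega⟩, ⟨d (Sum.inr 1), by omega⟩)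
  · intro c
    refine ⟨⟨∑ x : Fin (a + 1) × Fin (b + 1), monomial (expo a b x.1 x.2) (c x), ?_⟩, ?_⟩
    · refine Submodule.sum_mem _ fun x _ => ?_
      exact isWeightedHomogeneous_monomial _ _ _ (weight_expo (by omega) (by omega))
    · ext x
      rw [formsCoeff_apply, coeff_sum, Finset.sum_eq_single x]
      · simp
      · intro y _ hy
        rw [coeff_monomial, if_neg]
        intro h
        apply hy
        have h1 := DFunLike.congr_fun h (Sum.inl 1)
        have h2 := DFunLike.congr_fun h (Sum.inr 1)
        simp only [expo_inl_one, expo_inr_one] at h1 h2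
        exact Prod.ext (Fin.ext h1) (Fin.ext h2)
      · simp

/-- A form of bidegree `(a, b)` amounts to its `(a + 1) (b + 1)` coefficients. -/
noncomputable def formsEquiv (a b : ℕ) : forms K a b ≃ₗ[K] (Fin (a + 1) × Fin (b + 1) → K) :=
  LinearEquiv.ofBijective (formsCoeff a b) (formsCoeff_bijective a b)

instance (a b : ℕ) : FiniteDimensional K (forms K a b) :=
  LinearEquiv.finiteDimensional (formsEquiv a b).symm

theorem finrank_forms (a b : ℕ) : Module.finrank K (forms K a b) = (a + 1) * (b + 1) := by
  rw [(formsEquiv a b).finrank_eq]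
  simp

end Dimension

/-! ### Jets of forms at a finite set of points -/

section Jets

variable {K : Type*} [Field K]

/-- The index set of the jets of order less than `N P` at the points `P` of `Z`: a triple
`⟨P, d, i⟩` stands for the monomial of exponents `(i, d - i)` in local coordinates at `P`. -/
abbrev JetIndex (Z : Finset (P1 K × P1 K)) (N : P1 K × P1 K → ℕ) : Type _ :=
  Σ P : Z, Σ d : Fin (N P), Fin (d + 1)

theorem two_mul_card_jetIndex (Z : Finset (P1 K × P1 K)) (N : P1 K × P1 K → ℕ) :
    2 * Fintype.card (JetIndex Z N) = ∑ P ∈ Z, N P * (N P + 1) := by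
  simp only [Fintype.card_sigma, Fintype.card_fin]
  rw [Finset.mul_sum, ← Finset.sum_coe_sort Z]
  refine Finset.sum_congr rfl fun P _ => ?_
  rw [Fin.sum_univ_eq_sum_range (fun d => d + 1) (N P)]
  have h := Finset.sum_range_succ' (fun d => d) (N P)
  rw [add_zero] at h
  rw [← h, mul_comm, Finset.sum_range_id_mul_two]
  simp [mul_comm]

/-- The jets of a form of bidegree `(a, b)`. -/
noncomputable def jets (Z : Finset (P1 K × P1 K)) (N : P1 K × P1 K → ℕ) (a b : ℕ) :
    forms K a b →ₗ[K] (JetIndex Z N → K) :=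
  LinearMap.pi fun x => (lcoeff K (expo a b x.2.2 (x.2.1 - x.2.2))).comp
    ((frame x.1.1).toLinearMap.comp (forms K a b).subtype)

theorem jets_apply (Z : Finset (P1 K × P1 K)) (N : P1 K × P1 K → ℕ) (a b : ℕ)
    (F : forms K a b) (x : JetIndex Z N) :
    jets Z N a b F x = coeff (expo a b x.2.2 (x.2.1 - x.2.2)) (frame x.1.1 F.1) := rfl

theorem le_ord_of_jets_eq_zero {Z : Finset (P1 K × P1 K)} {N : P1 K × P1 K → ℕ} {a b : ℕ}
    {F : forms K a b} (h : jets Z N a b F = 0) (hF : F.1 ≠ 0) {P : P1 K × P1 K} (hP : P ∈ Z) :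
    N P ≤ ord P F.1 := by
  refine le_ord P hF fun d hd => ?_
  by_contra hne
  apply hne
  rw [eq_expo (IsBihomogeneous.map_frame F.2 P hne)]
  have h1 := congrFun h
    ⟨⟨P, hP⟩, ⟨d (Sum.inl 1) + d (Sum.inr 1), hd⟩, ⟨d (Sum.inl 1), by simp⟩⟩
  rw [jets_apply] at h1
  simpa using h1

theorem mem_pointIdeal_of_coeff_expo {P : P1 K × P1 K} {F : CoordRing K} {a b : ℕ}
    (hF : IsBihomogeneous F a b) (h : coeff (expo a b 0 0) (frame P F) = 0) :
    F ∈ pointIdeal P := by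
  rw [← pow_one (pointIdeal P)]
  refine mem_pointIdeal_pow_of_coeff P fun d hd => ?_
  by_contra hne
  have h1 := eq_expo (hF.map_frame P hne)
  rw [show d (Sum.inl 1) = 0 by omega, show d (Sum.inr 1) = 0 by omega] at h1
  rw [h1] at hne
  exact hne h

theorem exists_linear_forms_notMem (P : P1 K × P1 K) :
    ∃ ξ η : CoordRing K, IsBihomogeneous ξ 1 0 ∧ IsBihomogeneous η 0 1 ∧ ξ ∉ pointIdeal P ∧
      η ∉ pointIdeal P := by
  obtain ⟨i, hi⟩ := Function.ne_iff.mp P.1.rep_nonzero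
  obtain ⟨j, hj⟩ := Function.ne_iff.mp P.2.rep_nonzero
  refine ⟨X (Sum.inl i), X (Sum.inr j), isBihomogeneous_X_inl i, isBihomogeneous_X_inr j, ?_, ?_⟩
  · rw [(isBihomogeneous_X_inl i).mem_pointIdeal_iff]
    simpa using hi
  · rw [(isBihomogeneous_X_inr j).mem_pointIdeal_iff]
    simpa using hj

/-- In large bidegrees there are forms that vanish to prescribed order at the points of `Z` other
than `P` and do not vanish at `P`. -/
theorem exists_separating_form (Z : Finset (P1 K × P1 K)) (N : P1 K × P1 K → ℕ)
    (P : P1 K × P1 K) {a b : ℕ} (ha : ∑ Q ∈ Z, N Q ≤ a) (hb : ∑ Q ∈ Z, N Q ≤ b) :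
    ∃ S, IsBihomogeneous S a b ∧ S ∉ pointIdeal P ∧
      ∀ Q ∈ Z, Q ≠ P → S ∈ pointIdeal Q ^ N Q := by
  classical
  have hprime := isPrime_pointIdeal P
  choose! s u v hs hu hv hsQ hsP using fun Q (h : Q ≠ P) => exists_separating_fiber h
  obtain ⟨ξ, η, hξ, hη, hξP, hηP⟩ := exists_linear_forms_notMem P
  have hS : IsBihomogeneous (∏ Q ∈ Z.erase P, s Q ^ N Q) (∑ Q ∈ Z.erase P, N Q * u Q)
      (∑ Q ∈ Z.erase P, N Q * v Q) :=
    IsBihomogeneous.prod _ _ _ _ fun Q hQ => (hs Q (Finset.ne_of_mem_erase hQ)).pow _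
  have hbound : ∀ f : P1 K × P1 K → ℕ, (∀ Q, Q ≠ P → f Q ≤ 1) →
      ∑ Q ∈ Z.erase P, N Q * f Q ≤ ∑ Q ∈ Z, N Q := fun f hf =>
    (Finset.sum_le_sum fun Q hQ =>
      mul_le_of_le_one_right (Nat.zero_le _) (hf Q (Finset.ne_of_mem_erase hQ))).trans
      (Finset.sum_le_sum_of_subset (Finset.erase_subset P Z))
  have hu' := hbound u hu
  have hv' := hbound v hv
  refine ⟨(∏ Q ∈ Z.erase P, s Q ^ N Q) * (ξ ^ (a - ∑ Q ∈ Z.erase P, N Q * u Q) *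
    η ^ (b - ∑ Q ∈ Z.erase P, N Q * v Q)), ?_, ?_, ?_⟩
  · have h := hS.mul ((hξ.pow (a - ∑ Q ∈ Z.erase P, N Q * u Q)).mul
      (hη.pow (b - ∑ Q ∈ Z.erase P, N Q * v Q)))
    convert h using 1 <;> omega
  · intro hmem
    rcases hprime.mem_or_mem hmem with h | h
    · obtain ⟨Q, hQ, h1⟩ := Ideal.IsPrime.prod_mem_iff.mp h
      exact hsP Q (Finset.ne_of_mem_erase hQ) (hprime.mem_of_pow_mem _ h1)
    · rcases hprime.mem_or_mem h with h | h
      · exact hξP (hprime.mem_of_pow_mem _ h)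
      · exact hηP (hprime.mem_of_pow_mem _ h)
  · intro Q hQ hQP
    refine Ideal.mul_mem_right _ _ (Ideal.mem_of_dvd _
      (Finset.dvd_prod_of_mem (fun Q => s Q ^ N Q) (Finset.mem_erase.mpr ⟨hQP, hQ⟩)) ?_)
    exact Ideal.pow_mem_pow (hsQ Q hQP) _

theorem frame_fiber_monomial_mul (P : P1 K × P1 K) (i j : ℕ) (S : CoordRing K) :
    frame P (xFiber P.1 ^ i * yFiber P.2 ^ j * S) =
      monomial (expo i j i j) ((-1) ^ (i + j)) * frame P S := by
  rw [map_mul, map_mul, map_pow, map_pow, frame_xFiber, frame_yFiber, monomial_eq,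
    Finsupp.prod_fintype _ _ (by simp), Fintype.prod_sum_type]
  simp only [Fin.prod_univ_two, expo_inl_zero, expo_inl_one, expo_inr_zero, expo_inr_one,
    Nat.sub_self, pow_zero, one_mul, map_pow, map_neg, map_one]
  rw [neg_pow (X (Sum.inl 1) : CoordRing K), neg_pow (X (Sum.inr 1) : CoordRing K), pow_add]
  ring

/-- In large bidegrees there are forms with prescribed jets. -/
theorem jets_surjective (Z : Finset (P1 K × P1 K)) (N : P1 K × P1 K → ℕ) {a b : ℕ}
    (ha : 2 * ∑ Q ∈ Z, N Q ≤ a) (hb : 2 * ∑ Q ∈ Z, N Q ≤ b) :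
    Function.Surjective (jets Z N a b) := by
  classical
  rw [← LinearMap.range_eq_top]
  by_contra hne
  obtain ⟨f, hf0, hf⟩ := Submodule.exists_le_ker_of_lt_top _ (lt_top_iff_ne_top.mpr hne)
  have hfx : ∃ x, f (Pi.single x 1) ≠ 0 := by
    by_contra! h
    exact hf0 (LinearMap.pi_ext' fun x => LinearMap.ext_ring (by simpa using h x))
  -- A monomial of highest order on which the functional `f` does not vanish.
  obtain ⟨⟨P, d, i⟩, hx, hmax⟩ := Finset.exists_max_image
    (Finset.univ.filter fun x => f (Pi.single x 1) ≠ 0) (fun x => (x.2.1 : ℕ))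
    (by obtain ⟨x, hx⟩ := hfx; exact ⟨x, by simpa using hx⟩)
  rw [Finset.mem_filter] at hx
  have hNP : N P ≤ ∑ Q ∈ Z, N Q := Finset.single_le_sum (fun Q _ => Nat.zero_le (N Q)) P.2
  have hd := d.2
  have hi := i.2
  obtain ⟨S, hS, hSP, hSQ⟩ := exists_separating_form Z N P.1
    (a := a - i) (b := b - (d - i)) (by omega) (by omega)
  have hF : IsBihomogeneous (xFiber P.1.1 ^ (i : ℕ) * yFiber P.1.2 ^ (d - i : ℕ) * S) a b := by
    have h := (((isBihomogeneous_xFiber P.1.1).pow i).mul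
      ((isBihomogeneous_yFiber P.1.2).pow (d - i : ℕ))).mul hS
    convert h using 1 <;> omega
  have hS0 : S ≠ 0 := fun h => hSP (h ▸ Submodule.zero_mem _)
  have hx0 := pow_ne_zero (i : ℕ) (xFiber_ne_zero P.1.1)
  have hy0 := pow_ne_zero (d - i : ℕ) (yFiber_ne_zero P.1.2)
  set F : forms K a b := ⟨_, hF⟩ with hFdef
  have hF0 : F.1 ≠ 0 := mul_ne_zero (mul_ne_zero hx0 hy0) hS0
  have hker : f (jets Z N a b F) = 0 := hf ⟨F, rfl⟩
  have hsum : f (jets Z N a b F) = ∑ x, jets Z N a b F x * f (Pi.single x 1) := by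
    conv_lhs => rw [← Finset.univ_sum_single (jets Z N a b F), map_sum]
    refine Finset.sum_congr rfl fun x _ => ?_
    rw [← smul_eq_mul, ← map_smul, ← Pi.single_smul, smul_eq_mul, mul_one]
  rw [hsum, Finset.sum_eq_single ⟨P, d, i⟩] at hker
  · rcases mul_eq_zero.mp hker with h | h
    · apply hSP
      refine mem_pointIdeal_of_coeff_expo hS ?_
      rw [jets_apply, hFdef] at h
      dsimp only at h
      rw [frame_fiber_monomial_mul, coeff_monomial_mul', if_pos] at h
      · have h2 := (mul_eq_zero.mp h).resolve_left (pow_ne_zero _ (by simp))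
        convert h2 using 2
        ext z
        rcases z with z | z <;> fin_cases z <;> simp
      · intro z
        rcases z with z | z <;> fin_cases z <;> simp
    · exact hx.2 h
  · rintro ⟨Q, e, j⟩ - hne
    have hj := j.2
    by_cases hQ : Q = P
    · subst hQ
      by_cases hed : (d : ℕ) < e
      · have h0 : f (Pi.single ⟨Q, e, j⟩ 1) = 0 := by
          by_contra h1
          exact absurd (hmax ⟨Q, e, j⟩ (by simpa using h1)) (not_le.mpr hed)
        rw [h0, mul_zero]
      · rw [jets_apply, hFdef]
        dsimp only
        rw [frame_fiber_monomial_mul, coeff_monomial_mul', if_neg, zero_mul]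
        intro hle
        have h1 := hle (Sum.inl 1)
        have h2 := hle (Sum.inr 1)
        simp only [expo_inl_one, expo_inr_one] at h1 h2
        apply hne
        have h3 : e = d := Fin.ext (by omega)
        subst h3
        have h4 : j = i := Fin.ext (by omega)
        rw [h4]
    · have h1 : N Q ≤ ord Q.1 F.1 := by
        rw [← mem_pointIdeal_pow_iff _ hF0]
        exact Ideal.mul_mem_left _ _ (hSQ Q.1 Q.2 fun h => hQ (Subtype.ext h))
      rw [jets_apply, coeff_frame_eq_zero, zero_mul]
      have := e.2
      simp only [expo_inl_one, expo_inr_one]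
      omega
  · simp

end Jets

/-! ### Intersection numbers -/

section Bezout

variable {K : Type*} [Field K]

theorem finrank_range_le_of_ker_le {V W U : Type*} [AddCommGroup V] [Module K V]
    [FiniteDimensional K V] [AddCommGroup W] [Module K W] [AddCommGroup U] [Module K U]
    [FiniteDimensional K U] (f : V →ₗ[K] U) (g : V →ₗ[K] W) (h : f.ker ≤ g.ker) :
    Module.finrank K g.range ≤ Module.finrank K U := by
  have h1 := f.finrank_range_add_finrank_ker
  have h2 := g.finrank_range_add_finrank_ker
  have h3 := Submodule.finrank_mono h
  have h4 := Submodule.finrank_le f.range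
  omega

theorem finrank_ker_comp_le {V W U : Type*} [AddCommGroup V] [Module K V]
    [FiniteDimensional K V] [AddCommGroup W] [Module K W] [FiniteDimensional K W]
    [AddCommGroup U] [Module K U] (f : V →ₗ[K] W) (g : W →ₗ[K] U) :
    Module.finrank K (g.comp f).ker ≤ Module.finrank K f.ker + Module.finrank K g.ker := by
  have h1 : ∀ x : (g.comp f).ker, f.comp (g.comp f).ker.subtype x ∈ g.ker := fun x => x.2
  have h2 := ((f.comp (g.comp f).ker.subtype).codRestrict g.ker h1).finrank_range_add_finrank_ker
  have h3 := Submodule.finrank_le ((f.comp (g.comp f).ker.subtype).codRestrict g.ker h1).range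
  have h4 : Module.finrank K ((f.comp (g.comp f).ker.subtype).codRestrict g.ker h1).ker ≤
      Module.finrank K f.ker := by
    rw [LinearMap.ker_codRestrict]
    refine (LinearMap.finrank_le_finrank_of_injective
      (f := (g.comp f).ker.subtype.restrict (p := (f.comp (g.comp f).ker.subtype).ker)
        (q := f.ker) fun x hx => hx) ?_)
    intro x y hxy
    have h : (x.1.1 : V) = y.1.1 := congrArg (fun z : f.ker => (z : V)) hxy
    exact Subtype.ext (Subtype.ext h)
  omega

/-- Multiplication by a form, as a linear map between spaces of forms. -/
noncomputable def mulForm {F : CoordRing K} {p q a b c d : ℕ} (hF : IsBihomogeneous F p q)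
    (hc : p + a = c) (hd : q + b = d) : forms K a b →ₗ[K] forms K c d :=
  (LinearMap.mulLeft K F).restrict fun A hA => by
    subst hc hd
    exact hF.mul hA

@[simp] theorem coe_mulForm {F : CoordRing K} {p q a b c d : ℕ} (hF : IsBihomogeneous F p q)
    (hc : p + a = c) (hd : q + b = d) (A : forms K a b) :
    (mulForm hF hc hd A : CoordRing K) = F * A := rfl

/-- The Bézout inequality: coprime forms of bidegrees `(p, q)` and `(r, s)` have intersection
number `p s + q r`, and a common point of multiplicities `k` and `l` contributes at least `k l`.

In large bidegrees `p s + q r` is the codimension of the ideal `(F, G)`. The jets of order less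
than `k + l` of a multiple `A F` depend only on the jets of `A` of order less than `l`, so at most
`k (k + 1) / 2 + l (l + 1) / 2` of the `(k + l) (k + l + 1) / 2` dimensions of jets are reached
by elements of `(F, G)`. -/
theorem sum_ord_mul_ord_le {F G : CoordRing K} {p q r s : ℕ} (hF : IsBihomogeneous F p q)
    (hG : IsBihomogeneous G r s) (hF0 : F ≠ 0) (hG0 : G ≠ 0) (hFG : IsRelPrime F G)
    (Z : Finset (P1 K × P1 K)) : ∑ P ∈ Z, ord P F * ord P G ≤ p * s + q * r := by
  obtain ⟨n, hn⟩ : ∃ n, n = 2 * ∑ P ∈ Z, (ord P F + ord P G) := ⟨_, rfl⟩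
  let μ : forms K (n + r) (n + s) × forms K (n + p) (n + q) →ₗ[K]
      forms K (n + p + r) (n + q + s) :=
    (mulForm hF (by ring) (by ring)).coprod (mulForm hG (by ring) (by ring))
  have hμ : ∀ x, (μ x : CoordRing K) = F * x.1 + G * x.2 := fun x => rfl
  let ν : forms K n n →ₗ[K] forms K (n + r) (n + s) × forms K (n + p) (n + q) :=
    (mulForm hG (by ring) (by ring)).prod (-(mulForm hF (by ring) (by ring)))
  let J := jets Z (fun P => ord P F + ord P G) (n + p + r) (n + q + s)
  have hJ : Function.Surjective J := jets_surjective Z _ (by omega) (by omega)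
  let j := (jets Z (fun P => ord P G) (n + r) (n + s)).prodMap
    (jets Z (fun P => ord P F) (n + p) (n + q))
  -- Multiples of `F` and of `G` have few jets.
  have h1 : j.ker ≤ (J.comp μ).ker := by
    rintro ⟨A, B⟩ h
    rw [LinearMap.mem_ker, LinearMap.prodMap_apply, Prod.mk_eq_zero] at h
    rw [LinearMap.mem_ker]
    ext ⟨P, d, i⟩
    have hi := i.2
    have hd : (d : ℕ) < ord P.1 F + ord P.1 G := d.2
    have hsum : ∀ C : CoordRing K, (C ≠ 0 → ord P.1 F + ord P.1 G ≤ ord P.1 C) →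
        coeff (expo (n + p + r) (n + q + s) i (d - i)) (frame P.1 C) = 0 := by
      intro C hC
      by_cases hC0 : C = 0
      · rw [hC0, map_zero, coeff_zero]
      · refine coeff_frame_eq_zero P.1 (lt_of_lt_of_le ?_ (hC hC0))
        simp only [expo_inl_one, expo_inr_one]
        omega
    rw [LinearMap.comp_apply, jets_apply, hμ, map_add, coeff_add, hsum, hsum, add_zero]
    · rfl
    · intro h0
      have hB := right_ne_zero_of_mul h0
      rw [ord_mul _ hG0 hB, add_comm]
      exact Nat.add_le_add_left (le_ord_of_jets_eq_zero h.2 hB P.2) _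
    · intro h0
      have hA := right_ne_zero_of_mul h0
      rw [ord_mul _ hF0 hA]
      exact Nat.add_le_add_left (le_ord_of_jets_eq_zero h.1 hA P.2) _
  -- The only relations between `F` and `G` are the obvious ones.
  have h2 : μ.ker ≤ ν.range := by
    rintro ⟨A, B⟩ h
    have h3 : F * A.1 + G * B.1 = 0 := congrArg Subtype.val h
    have h4 : G ∣ A.1 := by
      refine IsRelPrime.dvd_of_dvd_mul_left hFG.symm ⟨-B.1, ?_⟩
      linear_combination h3
    obtain ⟨D, hD⟩ := h4
    have h5 : G * (F * D + B.1) = 0 := by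
      rw [hD] at h3
      linear_combination h3
    have h6 : B.1 = -(F * D) := by
      linear_combination (mul_eq_zero.mp h5).resolve_left hG0
    have hDf : IsBihomogeneous D n n := by
      by_cases hD0 : D = 0
      · rw [hD0]; exact isWeightedHomogeneous_zero _ _ _
      · have h7 := A.2
        rw [hD, mem_forms] at h7
        have h8 := (hG.cofactor h7 (mul_ne_zero hG0 hD0)).2.2
        simpa using h8
    refine ⟨⟨D, hDf⟩, Prod.ext (Subtype.ext hD.symm) (Subtype.ext h6.symm)⟩
  have c1 := finrank_range_le_of_ker_le j (J.comp μ) h1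
  have c2 := finrank_ker_comp_le μ J
  have c3 := (J.comp μ).finrank_range_add_finrank_ker
  have c4 := (Submodule.finrank_mono h2).trans (LinearMap.finrank_range_le ν)
  have c5 := J.finrank_range_add_finrank_ker
  rw [LinearMap.range_eq_top.mpr hJ, finrank_top] at c5
  rw [Module.finrank_prod] at c1 c3
  simp only [Module.finrank_fintype_fun_eq_card, finrank_forms] at c1 c3 c4 c5
  have e1 := two_mul_card_jetIndex Z (fun P => ord P F + ord P G)
  have e2 := two_mul_card_jetIndex Z (fun P => ord P F)
  have e3 := two_mul_card_jetIndex Z (fun P => ord P G)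
  have e4 : ∑ P ∈ Z, (ord P F + ord P G) * (ord P F + ord P G + 1) =
      ∑ P ∈ Z, ord P F * (ord P F + 1) + ∑ P ∈ Z, ord P G * (ord P G + 1) +
        2 * ∑ P ∈ Z, ord P F * ord P G := by
    rw [Finset.mul_sum, ← Finset.sum_add_distrib, ← Finset.sum_add_distrib]
    exact Finset.sum_congr rfl fun P _ => by ring
  have e5 : (n + p + r + 1) * (n + q + s + 1) + (n + 1) * (n + 1) =
      (n + r + 1) * (n + s + 1) + (n + p + 1) * (n + q + 1) + (p * s + q * r) := by ring
  omega

end Bezout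

/-! ### Forms with multiple points at a set on no curve of small degree -/

section Unisolvent

variable {K : Type*} [Field K]

/-- No nonzero form of bidegree `(b, b)` vanishes on `Z`. -/
def Determines (Z : Finset (P1 K × P1 K)) (b : ℕ) : Prop :=
  ∀ F, IsBihomogeneous F b b → F ∈ pointsIdeal Z → F = 0

theorem Determines.le_card {Z : Finset (P1 K × P1 K)} {b : ℕ} (h : Determines Z b) :
    (b + 1) * (b + 1) ≤ Z.card := by
  let f : forms K b b →ₗ[K] (Z → K) := LinearMap.pi fun P =>
    (aeval (Sum.elim P.1.1.rep P.1.2.rep) : CoordRing K →ₐ[K] K).toLinearMap.comp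
      (forms K b b).subtype
  have hf : Function.Injective f := by
    rw [injective_iff_map_eq_zero]
    rintro ⟨F, hF⟩ h0
    refine Subtype.ext (h F hF (mem_pointsIdeal.mpr fun P hP => ?_))
    rw [IsBihomogeneous.mem_pointIdeal_iff P hF]
    exact congrFun h0 ⟨P, hP⟩
  have h1 := LinearMap.finrank_le_finrank_of_injective hf
  rw [finrank_forms, Module.finrank_fintype_fun_eq_card, Fintype.card_coe] at h1
  exact h1

/-- A minimal determining subset comes with a dual family of forms. -/
theorem Determines.exists_dual {Z : Finset (P1 K × P1 K)} {b : ℕ} (h : Determines Z b) :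
    ∃ Y ⊆ Z, Determines Y b ∧ ∃ L : P1 K × P1 K → CoordRing K, ∀ P ∈ Y,
      IsBihomogeneous (L P) b b ∧ L P ∉ pointIdeal P ∧ ∀ Q ∈ Y, Q ≠ P → L P ∈ pointIdeal Q := by
  classical
  obtain ⟨Y, hY, hmin⟩ := Finset.exists_min_image (Z.powerset.filter fun Y => Determines Y b)
    Finset.card ⟨Z, by simpa using h⟩
  simp only [Finset.mem_filter, Finset.mem_powerset] at hY hmin
  refine ⟨Y, hY.1, hY.2, ?_⟩
  have key : ∀ P ∈ Y, ∃ L : CoordRing K, IsBihomogeneous L b b ∧ L ∉ pointIdeal P ∧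
      ∀ Q ∈ Y, Q ≠ P → L ∈ pointIdeal Q := by
    intro P hP
    have h1 : ¬ Determines (Y.erase P) b := fun hd =>
      absurd (hmin (Y.erase P) ⟨(Finset.erase_subset P Y).trans hY.1, hd⟩)
        (not_le.mpr (Finset.card_erase_lt_of_mem hP))
    simp only [Determines, not_forall] at h1
    obtain ⟨L, hL, hLY, hL0⟩ := h1
    rw [mem_pointsIdeal] at hLY
    refine ⟨L, hL, fun hLP => hL0 (hY.2 L hL (mem_pointsIdeal.mpr fun Q hQ => ?_)),
      fun Q hQ hQP => hLY Q (Finset.mem_erase.mpr ⟨hQP, hQ⟩)⟩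
    by_cases hQP : Q = P
    · rwa [hQP]
    · exact hLY Q (Finset.mem_erase.mpr ⟨hQP, hQ⟩)
  choose! L hL using key
  exact ⟨L, hL⟩

/-- The dual family spans, so a common divisor of it divides every form. -/
theorem Determines.dvd_of_dvd_dual {Y : Finset (P1 K × P1 K)} {b : ℕ} (h : Determines Y b)
    {L : P1 K × P1 K → CoordRing K} (hL : ∀ P ∈ Y, IsBihomogeneous (L P) b b ∧
      L P ∉ pointIdeal P ∧ ∀ Q ∈ Y, Q ≠ P → L P ∈ pointIdeal Q) {D G : CoordRing K}
    (hD : ∀ P ∈ Y, D ∣ L P) (hG : IsBihomogeneous G b b) : D ∣ G := by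
  classical
  let ev : P1 K × P1 K → CoordRing K →+* K := fun P => eval (Sum.elim P.1.rep P.2.rep)
  have hS : IsBihomogeneous (∑ P ∈ Y, C (ev P G / ev P (L P)) * L P) b b :=
    IsWeightedHomogeneous.sum _ _ _ fun P hP => (hL P hP).1.C_mul _
  have h0 : G - ∑ P ∈ Y, C (ev P G / ev P (L P)) * L P = 0 := by
    refine h _ (hG.sub hS) (mem_pointsIdeal.mpr fun P hP => ?_)
    rw [(hG.sub hS).mem_pointIdeal_iff P, map_sub, map_sum, Finset.sum_eq_single P]
    · have h1 : ev P (L P) ≠ 0 := fun h1 =>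
        (hL P hP).2.1 (((hL P hP).1.mem_pointIdeal_iff P).mpr h1)
      rw [map_mul, eval_C]
      change ev P G - ev P G / ev P (L P) * ev P (L P) = 0
      rw [div_mul_cancel₀ _ h1, sub_self]
    · intro Q hQ hQP
      have h1 := ((hL Q hQ).1.mem_pointIdeal_iff P).mp ((hL Q hQ).2.2 P hP hQP.symm)
      rw [map_mul, h1, mul_zero]
    · exact fun h1 => absurd hP h1
  rw [sub_eq_zero.mp h0]
  exact Finset.dvd_sum fun P hP => dvd_mul_of_dvd_right (hD P hP) _

theorem not_prime_dvd_all_forms {D : CoordRing K} (hD : Prime D) (b : ℕ) :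
    ∃ G, IsBihomogeneous G b b ∧ ¬ D ∣ G := by
  by_contra! h
  have key : ∀ i j : Fin 2, ∃ z : Fin 2 ⊕ Fin 2, (z = Sum.inl i ∨ z = Sum.inr j) ∧
      D ∣ X z := by
    intro i j
    have h1 : IsBihomogeneous (X (Sum.inl i) ^ b * X (Sum.inr j) ^ b : CoordRing K) b b := by
      simpa using ((isBihomogeneous_X_inl i).pow b).mul ((isBihomogeneous_X_inr j).pow b)
    rcases hD.dvd_or_dvd (h _ h1) with h2 | h2
    · exact ⟨_, Or.inl rfl, hD.dvd_of_dvd_pow h2⟩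
    · exact ⟨_, Or.inr rfl, hD.dvd_of_dvd_pow h2⟩
  obtain ⟨z, hz, hDz⟩ := key 0 0
  obtain ⟨z', hz', hDz'⟩ := key 1 1
  have h2 : (X z : CoordRing K) ∣ X z' :=
    (hD.associated_of_dvd X_prime hDz).symm.dvd.trans hDz'
  rw [X_dvd_X] at h2
  subst h2
  rcases hz with rfl | rfl <;> simp at hz'

/-- If no form of bidegree `(b, b)` vanishes on `Z`, then the forms of bidegrees `(b + 1, b)` and
`(b, b + 1)` that vanish on a suitable subset have no common component. Comparing with each
irreducible component of `F` bounds the multiplicities of `F` on that subset. -/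
theorem Determines.exists_sum_ord_le {Z : Finset (P1 K × P1 K)} {b : ℕ} (h : Determines Z b) :
    ∃ Y ⊆ Z, (b + 1) * (b + 1) ≤ Y.card ∧ ∀ (F : CoordRing K) (r s : ℕ), F ≠ 0 →
      IsBihomogeneous F r s → ∑ P ∈ Y, ord P F ≤ (b + 1) * (r + s) := by
  obtain ⟨Y, hYZ, hY, L, hL⟩ := h.exists_dual
  refine ⟨Y, hYZ, hY.le_card, ?_⟩
  have hprime : ∀ (D : CoordRing K) (p q : ℕ), Prime D → IsBihomogeneous D p q →
      ∑ P ∈ Y, ord P D ≤ (b + 1) * (p + q) := by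
    intro D p q hD hpq
    obtain ⟨G₀, hG₀, hDG₀⟩ := not_prime_dvd_all_forms hD b
    obtain ⟨P, hP, hDP⟩ : ∃ P ∈ Y, ¬ D ∣ L P := by
      by_contra! hdvd
      exact hDG₀ (hY.dvd_of_dvd_dual hL hdvd hG₀)
    have hL0 : L P ≠ 0 := fun h0 => (hL P hP).2.1 (h0 ▸ Submodule.zero_mem _)
    have bound : ∀ (E : CoordRing K) (u v : ℕ), IsBihomogeneous E u v → E ≠ 0 → ¬ D ∣ E →
        E ∈ pointIdeal P → ∑ Q ∈ Y, ord Q D ≤ p * (b + v) + q * (b + u) := by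
      intro E u v hE hE0 hDE hEP
      have h1 : IsRelPrime D (L P * E) :=
        hD.irreducible.isRelPrime_iff_not_dvd.mpr fun h2 => (hD.dvd_or_dvd h2).elim hDP hDE
      refine le_trans (Finset.sum_le_sum fun Q hQ => ?_)
        (sum_ord_mul_ord_le hpq ((hL P hP).1.mul hE) hD.ne_zero (mul_ne_zero hL0 hE0) h1 Y)
      refine le_mul_of_one_le_right (Nat.zero_le _) ?_
      rw [← mem_pointIdeal_iff_ord Q (mul_ne_zero hL0 hE0)]
      by_cases hQP : Q = P
      · rw [hQP]; exact Ideal.mul_mem_left _ _ hEP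
      · exact Ideal.mul_mem_right _ _ ((hL P hP).2.2 Q hQ hQP)
    by_cases hDx : D ∣ xFiber P.1
    · by_cases hDy : D ∣ yFiber P.2
      · exfalso
        obtain ⟨A, hA⟩ := hDx
        obtain ⟨B, hB⟩ := hDy
        have h1 := hpq.cofactor (hA ▸ isBihomogeneous_xFiber P.1) (hA ▸ xFiber_ne_zero P.1)
        have h2 := hpq.cofactor (hB ▸ isBihomogeneous_yFiber P.2) (hB ▸ yFiber_ne_zero P.2)
        obtain rfl : p = 0 := by omega
        obtain rfl : q = 0 := by omega
        exact hD.not_isUnit (isUnit_of_isBihomogeneous_zero hD.ne_zero hpq)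
      · refine (bound _ _ _ (isBihomogeneous_yFiber P.2) (yFiber_ne_zero _) hDy
          (yFiber_mem P)).trans ?_
        rw [add_zero, mul_comm p, mul_comm q, mul_add]
        exact Nat.add_le_add_left (Nat.mul_le_mul_right _ (Nat.le_succ b)) _
    · refine (bound _ _ _ (isBihomogeneous_xFiber P.1) (xFiber_ne_zero _) hDx
        (xFiber_mem P)).trans ?_
      rw [add_zero, mul_comm p, mul_comm q, mul_add]
      exact Nat.add_le_add_right (Nat.mul_le_mul_right _ (Nat.le_succ b)) _
  intro F
  induction F using UniqueFactorizationMonoid.induction_on_prime with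
  | h₁ => exact fun r s h0 => absurd rfl h0
  | h₂ u hu =>
    intro r s h0 _
    obtain ⟨v, hv⟩ := isUnit_iff_exists_inv.mp hu
    have hv0 : v ≠ 0 := right_ne_zero_of_mul (hv ▸ one_ne_zero)
    have h1 : ∀ P ∈ Y, ord P u = 0 := fun P _ => by
      have h2 := ord_mul P h0 hv0
      rw [hv, ord_one] at h2
      omega
    rw [Finset.sum_eq_zero h1]
    exact Nat.zero_le _
  | h₃ A D hA0 hD ih =>
    intro r s h0 hrs
    obtain ⟨p, q, p', q', h1, h2, rfl, rfl⟩ := isBihomogeneous_of_mul hrs h0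
    have h3 := hprime D p q hD h1
    have h4 := ih p' q' hA0 h2
    rw [Finset.sum_congr rfl fun P _ => ord_mul P hD.ne_zero hA0, Finset.sum_add_distrib]
    calc _ ≤ (b + 1) * (p + q) + (b + 1) * (p' + q') := Nat.add_le_add h3 h4
      _ = _ := by ring

end Unisolvent

/-! ### Fibres and curves of bidegree (1, 1) -/

section Curves

variable {K : Type*} [Field K]

theorem ord_eq_zero {P : P1 K × P1 K} {F : CoordRing K} (hF : F ∉ pointIdeal P) : ord P F = 0 := by
  have hF0 : F ≠ 0 := fun h => hF (h ▸ Submodule.zero_mem _)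
  rw [mem_pointIdeal_iff_ord P hF0] at hF
  omega

open Classical in
theorem ord_xFiber (P : P1 K × P1 K) (p : P1 K) :
    ord P (xFiber p) = if p = P.1 then 1 else 0 := by
  split_ifs with h
  · subst h
    refine le_antisymm ?_
      ((mem_pointIdeal_iff_ord P (xFiber_ne_zero _)).mp (xFiber_mem P))
    by_contra hlt
    have h1 := coeff_frame_eq_zero P (F := xFiber P.1) (d := Finsupp.single (Sum.inl 1) 1)
      (by simpa using hlt)
    rw [frame_xFiber, coeff_neg, coeff_X, if_pos rfl] at h1
    simp at h1
  · exact ord_eq_zero fun h1 => h (xFiber_mem_iff.mp h1)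

open Classical in
theorem ord_yFiber (P : P1 K × P1 K) (q : P1 K) :
    ord P (yFiber q) = if q = P.2 then 1 else 0 := by
  split_ifs with h
  · subst h
    refine le_antisymm ?_
      ((mem_pointIdeal_iff_ord P (yFiber_ne_zero _)).mp (yFiber_mem P))
    by_contra hlt
    have h1 := coeff_frame_eq_zero P (F := yFiber P.2) (d := Finsupp.single (Sum.inr 1) 1)
      (by simpa using hlt)
    rw [frame_yFiber, coeff_neg, coeff_X, if_pos rfl] at h1
    simp at h1
  · exact ord_eq_zero fun h1 => h (yFiber_mem_iff.mp h1)

theorem sum_ord_mul_ord_le_of_prime {D F : CoordRing K} {p q r s : ℕ} (hD : Prime D)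
    (hpq : IsBihomogeneous D p q) (hrs : IsBihomogeneous F r s) (hF0 : F ≠ 0) (hDF : ¬ D ∣ F)
    (Z : Finset (P1 K × P1 K)) : ∑ P ∈ Z, ord P D * ord P F ≤ p * s + q * r :=
  sum_ord_mul_ord_le hpq hrs hD.ne_zero hF0 (hD.irreducible.isRelPrime_iff_not_dvd.mpr hDF) Z

/-- Removing the components of `F` among finitely many given curves leaves a form that meets each
of these curves properly. -/
theorem exists_residual {ι κ : Type*} [Fintype ι] [Fintype κ] (P : κ → P1 K × P1 K)
    (hP : Function.Injective P) (D : ι → CoordRing K) (p q : ι → ℕ) (m : κ → ι → ℕ)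
    (hD : ∀ i, Prime (D i)) (hpq : ∀ i, IsBihomogeneous (D i) (p i) (q i))
    (hm : ∀ j i, ord (P j) (D i) = m j i) {F : CoordRing K} {r s : ℕ} (hF0 : F ≠ 0)
    (hF : IsBihomogeneous F r s) :
    ∃ (e : ι → ℕ) (u v : ℕ) (o : κ → ℕ), u + ∑ i, e i * p i = r ∧ v + ∑ i, e i * q i = s ∧
      (∀ j, ord (P j) F = o j + ∑ i, e i * m j i) ∧
      ∀ i, ∑ j, o j * m j i ≤ u * q i + v * p i := by
  classical
  obtain ⟨n, hn⟩ : ∃ n, n = r + s := ⟨_, rfl⟩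
  induction n using Nat.strong_induction_on generalizing F r s with
  | _ n ih =>
    by_cases hdvd : ∃ i, D i ∣ F
    · obtain ⟨i, G, rfl⟩ := hdvd
      have hG0 := right_ne_zero_of_mul hF0
      obtain ⟨h1, h2, hG⟩ := (hpq i).cofactor hF hF0
      have hne : p i + q i ≠ 0 := by
        intro h0
        have h3 := hpq i
        rw [show p i = 0 by omega, show q i = 0 by omega] at h3
        exact (hD i).not_isUnit (isUnit_of_isBihomogeneous_zero (hD i).ne_zero h3)
      obtain ⟨e, u, v, o, hr, hs, ho, hb⟩ := ih _ (by omega) hG0 hG rfl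
      have hsum : ∀ f : ι → ℕ, ∑ j, (e j + if j = i then 1 else 0) * f j =
          ∑ j, e j * f j + f i := fun f => by
        simp [add_mul, Finset.sum_add_distrib]
      refine ⟨fun j => e j + if j = i then 1 else 0, u, v, o, ?_, ?_, fun j => ?_, hb⟩
      · rw [hsum]; omega
      · rw [hsum]; omega
      · rw [hsum, ord_mul _ (hD i).ne_zero hG0, ho, hm]; ring
    · push Not at hdvd
      refine ⟨0, r, s, fun j => ord (P j) F, by simp, by simp, by simp, fun i => ?_⟩
      have h := sum_ord_mul_ord_le_of_prime (hD i) (hpq i) hF hF0 (hdvd i)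
        (Finset.univ.image P)
      rw [Finset.sum_image fun a _ b _ hab => hP hab] at h
      simp only [hm] at h
      calc _ = ∑ j, m j i * ord (P j) F := Finset.sum_congr rfl fun j _ => mul_comm _ _
        _ ≤ _ := h
        _ = _ := by ring

theorem fst_eq_of_mem {F : CoordRing K} (hF : IsBihomogeneous F 1 0) (hF0 : F ≠ 0)
    {P Q : P1 K × P1 K} (hP : F ∈ pointIdeal P) (hQ : F ∈ pointIdeal Q) : P.1 = Q.1 := by
  classical
  by_cases hdvd : xFiber P.1 ∣ F
  · obtain ⟨c, rfl⟩ := hdvd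
    have hc := ((isBihomogeneous_xFiber P.1).cofactor hF hF0).2.2
    have hu := isUnit_of_isBihomogeneous_zero (right_ne_zero_of_mul hF0) hc
    exact xFiber_mem_iff.mp ((Ideal.mul_unit_mem_iff_mem _ hu).mp hQ)
  · have h := sum_ord_mul_ord_le_of_prime (prime_xFiber P.1) (isBihomogeneous_xFiber _) hF hF0
      hdvd {P}
    rw [Finset.sum_singleton, ord_xFiber, if_pos rfl] at h
    have := (mem_pointIdeal_iff_ord P hF0).mp hP
    omega

theorem snd_eq_of_mem {F : CoordRing K} (hF : IsBihomogeneous F 0 1) (hF0 : F ≠ 0)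
    {P Q : P1 K × P1 K} (hP : F ∈ pointIdeal P) (hQ : F ∈ pointIdeal Q) : P.2 = Q.2 := by
  classical
  by_cases hdvd : yFiber P.2 ∣ F
  · obtain ⟨c, rfl⟩ := hdvd
    have hc := ((isBihomogeneous_yFiber P.2).cofactor hF hF0).2.2
    have hu := isUnit_of_isBihomogeneous_zero (right_ne_zero_of_mul hF0) hc
    exact yFiber_mem_iff.mp ((Ideal.mul_unit_mem_iff_mem _ hu).mp hQ)
  · have h := sum_ord_mul_ord_le_of_prime (prime_yFiber P.2) (isBihomogeneous_yFiber _) hF hF0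
      hdvd {P}
    rw [Finset.sum_singleton, ord_yFiber, if_pos rfl] at h
    have := (mem_pointIdeal_iff_ord P hF0).mp hP
    omega

theorem exists_conic (A B C : P1 K × P1 K) :
    ∃ D, IsBihomogeneous D 1 1 ∧ D ≠ 0 ∧ D ∈ pointIdeal A ∧ D ∈ pointIdeal B ∧
      D ∈ pointIdeal C := by
  let f : forms K 1 1 →ₗ[K] (Fin 3 → K) := LinearMap.pi fun i =>
    (aeval (Sum.elim (![A, B, C] i).1.rep (![A, B, C] i).2.rep) :
      CoordRing K →ₐ[K] K).toLinearMap.comp (forms K 1 1).subtype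
  have hf : f.ker ≠ ⊥ := LinearMap.ker_ne_bot_of_finrank_lt (by
    rw [finrank_forms, Module.finrank_fin_fun]; norm_num)
  obtain ⟨⟨D, hD⟩, hker, hD0⟩ := Submodule.exists_mem_ne_zero_of_ne_bot hf
  have h : ∀ i : Fin 3, D ∈ pointIdeal (![A, B, C] i) := fun i => by
    rw [IsBihomogeneous.mem_pointIdeal_iff _ hD]
    exact congrFun hker i
  exact ⟨D, hD, fun h0 => hD0 (Subtype.ext h0), h 0, h 1, h 2⟩

/-- A form of bidegree `(1, 1)` through three points no two of which lie on a common fibre is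
irreducible: otherwise it would be a product of two fibres, one of which would contain two of the
points. -/
theorem prime_of_conic {D : CoordRing K} (hD : IsBihomogeneous D 1 1) (hD0 : D ≠ 0)
    {A B C : P1 K × P1 K} (hA : D ∈ pointIdeal A) (hB : D ∈ pointIdeal B)
    (hC : D ∈ pointIdeal C) (hx₁ : A.1 ≠ B.1) (hx₂ : A.1 ≠ C.1) (hx₃ : B.1 ≠ C.1)
    (hy₁ : A.2 ≠ B.2) (hy₂ : A.2 ≠ C.2) (hy₃ : B.2 ≠ C.2) : Prime D := by
  have key : ∀ U W : CoordRing K, U * W = D →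
      ¬ (IsBihomogeneous U 1 0 ∧ IsBihomogeneous W 0 1) := by
    rintro U W rfl ⟨hU, hW⟩
    have hU0 := left_ne_zero_of_mul hD0
    have hW0 := right_ne_zero_of_mul hD0
    have hx := fun {P Q} => fst_eq_of_mem hU hU0 (P := P) (Q := Q)
    have hy := fun {P Q} => snd_eq_of_mem hW hW0 (P := P) (Q := Q)
    rcases (isPrime_pointIdeal A).mem_or_mem hA with a | a <;>
    rcases (isPrime_pointIdeal B).mem_or_mem hB with b | b <;>
    rcases (isPrime_pointIdeal C).mem_or_mem hC with c | c
    · exact hx₁ (hx a b)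
    · exact hx₁ (hx a b)
    · exact hx₂ (hx a c)
    · exact hy₃ (hy b c)
    · exact hx₃ (hx b c)
    · exact hy₂ (hy a c)
    · exact hy₁ (hy a b)
    · exact hy₁ (hy a b)
  refine Irreducible.prime ⟨not_isUnit_of_isBihomogeneous hD (by norm_num), fun U W hUW => ?_⟩
  have hUW0 : U * W ≠ 0 := hUW ▸ hD0
  obtain ⟨a, b, c, d, hU, hW, hac, hbd⟩ := isBihomogeneous_of_mul (hUW ▸ hD) hUW0
  have h : (a = 0 ∧ b = 0) ∨ (c = 0 ∧ d = 0) ∨ (a = 1 ∧ b = 0 ∧ c = 0 ∧ d = 1) ∨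
      (a = 0 ∧ b = 1 ∧ c = 1 ∧ d = 0) := by omega
  rcases h with ⟨rfl, rfl⟩ | ⟨rfl, rfl⟩ | ⟨rfl, rfl, rfl, rfl⟩ | ⟨rfl, rfl, rfl, rfl⟩
  · exact Or.inl (isUnit_of_isBihomogeneous_zero (left_ne_zero_of_mul hUW0) hU)
  · exact Or.inr (isUnit_of_isBihomogeneous_zero (right_ne_zero_of_mul hUW0) hW)
  · exact absurd ⟨hU, hW⟩ (key U W hUW.symm)
  · exact absurd ⟨hW, hU⟩ (key W U (by rw [mul_comm, hUW]))

theorem not_dvd_of_prime_conic {D : CoordRing K} (hD : IsBihomogeneous D 1 1) {G : CoordRing K}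
    {a b : ℕ} (hG : IsBihomogeneous G a b) (hG0 : G ≠ 0) (hab : a = 0 ∨ b = 0) : ¬ D ∣ G := by
  rintro ⟨E, rfl⟩
  have := hD.cofactor hG hG0
  omega

/-- An irreducible curve of bidegree `(1, 1)` is smooth. -/
theorem ord_conic_eq_one {D : CoordRing K} (hD : IsBihomogeneous D 1 1) (hp : Prime D)
    {P : P1 K × P1 K} (hP : D ∈ pointIdeal P) : ord P D = 1 := by
  classical
  have h := sum_ord_mul_ord_le_of_prime hp hD (isBihomogeneous_xFiber P.1) (xFiber_ne_zero _)
    (not_dvd_of_prime_conic hD (isBihomogeneous_xFiber P.1) (xFiber_ne_zero _) (Or.inr rfl)) {P}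
  rw [Finset.sum_singleton, ord_xFiber, if_pos rfl] at h
  have := (mem_pointIdeal_iff_ord P hp.ne_zero).mp hP
  omega

/-- An irreducible curve of bidegree `(1, 1)` meets every fibre in at most one point. -/
theorem ord_conic_eq_zero {D : CoordRing K} (hD : IsBihomogeneous D 1 1) (hp : Prime D)
    {P Q : P1 K × P1 K} (hP : D ∈ pointIdeal P) (hPQ : P ≠ Q) (h : P.1 = Q.1 ∨ P.2 = Q.2) :
    ord Q D = 0 := by
  classical
  by_contra hne
  have hQ : D ∈ pointIdeal Q := by
    by_contra hQ; exact hne (ord_eq_zero hQ)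
  have hP1 := ord_conic_eq_one hD hp hP
  have hQ1 := ord_conic_eq_one hD hp hQ
  rcases h with h | h
  · have h1 := sum_ord_mul_ord_le_of_prime hp hD (isBihomogeneous_xFiber P.1) (xFiber_ne_zero _)
      (not_dvd_of_prime_conic hD (isBihomogeneous_xFiber P.1) (xFiber_ne_zero _) (Or.inr rfl))
      {P, Q}
    rw [Finset.sum_pair hPQ, ord_xFiber, ord_xFiber, if_pos rfl, if_pos h, hP1, hQ1] at h1
    omega
  · have h1 := sum_ord_mul_ord_le_of_prime hp hD (isBihomogeneous_yFiber P.2) (yFiber_ne_zero _)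
      (not_dvd_of_prime_conic hD (isBihomogeneous_yFiber P.2) (yFiber_ne_zero _) (Or.inl rfl))
      {P, Q}
    rw [Finset.sum_pair hPQ, ord_yFiber, ord_yFiber, if_pos rfl, if_pos h, hP1, hQ1] at h1
    omega

/-- Three points lie on at most one irreducible curve of bidegree `(1, 1)`. -/
theorem conic_unique {D E : CoordRing K} (hD : IsBihomogeneous D 1 1) (hp : Prime D)
    (hE : IsBihomogeneous E 1 1) (hE0 : E ≠ 0) {A B C : P1 K × P1 K} (hAB : A ≠ B) (hAC : A ≠ C)
    (hBC : B ≠ C) (hA : D ∈ pointIdeal A) (hB : D ∈ pointIdeal B) (hC : D ∈ pointIdeal C)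
    (hA' : E ∈ pointIdeal A) (hB' : E ∈ pointIdeal B) (hC' : E ∈ pointIdeal C) : D ∣ E := by
  classical
  by_contra hdvd
  have h := sum_ord_mul_ord_le_of_prime hp hD hE hE0 hdvd {A, B, C}
  rw [Finset.sum_insert (by simp [hAB, hAC]), Finset.sum_pair hBC, ord_conic_eq_one hD hp hA,
    ord_conic_eq_one hD hp hB, ord_conic_eq_one hD hp hC] at h
  rw [mem_pointIdeal_iff_ord _ hE0] at hA' hB' hC'
  omega

end Curves

/-! ### Configurations of four points -/

section Configurations

variable {K : Type*} [Field K]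

/-- Four points in two rows (fibres of the second projection), forming a path with three columns
(fibres of the first). The linear program amounts to intersecting `F` with the class of curves of
bidegree `(3, 2)` that have double points at the two ends of the path and pass through the two inner
points: this class has intersection number zero with each of the five fibres. -/
theorem slope_path_of_two_rows {x₁ x₂ x₃ y₁ y₂ : P1 K} (h₁₂ : x₁ ≠ x₂) (h₁₃ : x₁ ≠ x₃)
    (h₂₃ : x₂ ≠ x₃) (hy : y₁ ≠ y₂) {F : CoordRing K} {d k : ℕ} (hF0 : F ≠ 0)
    (hF : IsBihomogeneous F d d) (hA : k ≤ ord (x₁, y₁) F) (hB : k ≤ ord (x₂, y₁) F)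
    (hC : k ≤ ord (x₂, y₂) F) (hE : k ≤ ord (x₃, y₂) F) : 6 * k ≤ 5 * d := by
  obtain ⟨e, u, v, o, hr, hs, ho, hb⟩ := exists_residual
    ![(x₁, y₁), (x₂, y₁), (x₂, y₂), (x₃, y₂)]
    (by
      intro i j
      fin_cases i <;> fin_cases j <;>
        simp [h₁₂, h₁₃, h₂₃, hy, h₁₂.symm, h₁₃.symm, h₂₃.symm, hy.symm])
    ![xFiber x₁, xFiber x₂, xFiber x₃, yFiber y₁, yFiber y₂]
    ![1, 1, 1, 0, 0] ![0, 0, 0, 1, 1]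
    ![![1, 0, 0, 1, 0], ![0, 1, 0, 1, 0], ![0, 1, 0, 0, 1], ![0, 0, 1, 0, 1]]
    (by simp [Fin.forall_fin_succ, prime_xFiber, prime_yFiber])
    (by simp [Fin.forall_fin_succ, isBihomogeneous_xFiber, isBihomogeneous_yFiber])
    (by
      simp [Fin.forall_fin_succ, ord_xFiber, ord_yFiber, h₁₂, h₁₃, h₂₃, hy, h₁₂.symm, h₁₃.symm,
        h₂₃.symm, hy.symm]) hF0 hF
  simp [Fin.forall_fin_succ, Fin.sum_univ_succ] at hr hs ho hb
  omega

/-- Four points in two columns, forming a path with three rows. -/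
theorem slope_path_of_three_rows {x₁ x₂ y₁ y₂ y₃ : P1 K} (h₁₂ : y₁ ≠ y₂) (h₁₃ : y₁ ≠ y₃)
    (h₂₃ : y₂ ≠ y₃) (hx : x₁ ≠ x₂) {F : CoordRing K} {d k : ℕ} (hF0 : F ≠ 0)
    (hF : IsBihomogeneous F d d) (hA : k ≤ ord (x₁, y₁) F) (hB : k ≤ ord (x₂, y₁) F)
    (hC : k ≤ ord (x₁, y₂) F) (hE : k ≤ ord (x₂, y₃) F) : 6 * k ≤ 5 * d := by
  obtain ⟨e, u, v, o, hr, hs, ho, hb⟩ := exists_residual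
    ![(x₁, y₁), (x₂, y₁), (x₁, y₂), (x₂, y₃)]
    (by
      intro i j
      fin_cases i <;> fin_cases j <;>
        simp [h₁₂, h₁₃, h₂₃, hx, h₁₂.symm, h₁₃.symm, h₂₃.symm, hx.symm])
    ![xFiber x₁, xFiber x₂, yFiber y₁, yFiber y₂, yFiber y₃]
    ![1, 1, 0, 0, 0] ![0, 0, 1, 1, 1]
    ![![1, 0, 1, 0, 0], ![0, 1, 1, 0, 0], ![1, 0, 0, 1, 0], ![0, 1, 0, 0, 1]]
    (by simp [Fin.forall_fin_succ, prime_xFiber, prime_yFiber])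
    (by simp [Fin.forall_fin_succ, isBihomogeneous_xFiber, isBihomogeneous_yFiber])
    (by
      simp [Fin.forall_fin_succ, ord_xFiber, ord_yFiber, h₁₂, h₁₃, h₂₃, hx, h₁₂.symm, h₁₃.symm,
        h₂₃.symm, hx.symm]) hF0 hF
  simp [Fin.forall_fin_succ, Fin.sum_univ_succ] at hr hs ho hb
  omega

/-- Two points in each of two rows, in four different columns. -/
theorem slope_two_pairs {x₁ x₂ x₃ x₄ y₁ y₂ : P1 K} (h₁₂ : x₁ ≠ x₂) (h₁₃ : x₁ ≠ x₃)
    (h₁₄ : x₁ ≠ x₄) (h₂₃ : x₂ ≠ x₃) (h₂₄ : x₂ ≠ x₄) (h₃₄ : x₃ ≠ x₄) (hy : y₁ ≠ y₂)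
    {F : CoordRing K} {d k : ℕ} (hF0 : F ≠ 0)
    (hF : IsBihomogeneous F d d) (hA : k ≤ ord (x₁, y₁) F) (hB : k ≤ ord (x₂, y₁) F)
    (hC : k ≤ ord (x₃, y₂) F) (hE : k ≤ ord (x₄, y₂) F) : 6 * k ≤ 5 * d := by
  obtain ⟨e, u, v, o, hr, hs, ho, hb⟩ := exists_residual
    ![(x₁, y₁), (x₂, y₁), (x₃, y₂), (x₄, y₂)]
    (by
      intro i j
      fin_cases i <;> fin_cases j <;>
        simp [h₁₂, h₁₃, h₁₄, h₂₃, h₂₄, h₃₄, hy, h₁₂.symm, h₁₃.symm, h₁₄.symm, h₂₃.symm, h₂₄.symm,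
          h₃₄.symm, hy.symm])
    ![xFiber x₁, xFiber x₂, xFiber x₃, xFiber x₄, yFiber y₁, yFiber y₂]
    ![1, 1, 1, 1, 0, 0] ![0, 0, 0, 0, 1, 1]
    ![![1, 0, 0, 0, 1, 0], ![0, 1, 0, 0, 1, 0], ![0, 0, 1, 0, 0, 1], ![0, 0, 0, 1, 0, 1]]
    (by simp [Fin.forall_fin_succ, prime_xFiber, prime_yFiber])
    (by simp [Fin.forall_fin_succ, isBihomogeneous_xFiber, isBihomogeneous_yFiber])
    (by
      simp [Fin.forall_fin_succ, ord_xFiber, ord_yFiber, h₁₂, h₁₃, h₁₄, h₂₃, h₂₄, h₃₄, hy,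
        h₁₂.symm, h₁₃.symm, h₁₄.symm, h₂₃.symm, h₂₄.symm, h₃₄.symm, hy.symm]) hF0 hF
  simp [Fin.forall_fin_succ, Fin.sum_univ_succ] at hr hs ho hb
  omega

/-- A corner: a point, a second one in its row, a third one in its column, and a fourth point on
other fibres. Besides fibres, the curve of bidegree `(1, 1)` through the last three of these points
is needed. -/
theorem slope_corner {x₁ x₂ x₃ y₁ y₂ y₃ : P1 K} (hx₁₂ : x₁ ≠ x₂) (hx₁₃ : x₁ ≠ x₃)
    (hx₂₃ : x₂ ≠ x₃) (hy₁₂ : y₁ ≠ y₂) (hy₁₃ : y₁ ≠ y₃) (hy₂₃ : y₂ ≠ y₃) {F : CoordRing K}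
    {d k : ℕ} (hF0 : F ≠ 0) (hF : IsBihomogeneous F d d) (hA : k ≤ ord (x₁, y₁) F)
    (hB : k ≤ ord (x₂, y₁) F) (hC : k ≤ ord (x₁, y₂) F) (hE : k ≤ ord (x₃, y₃) F) :
    6 * k ≤ 5 * d := by
  obtain ⟨D, hD, hD0, hDB, hDC, hDE⟩ := exists_conic (x₂, y₁) (x₁, y₂) (x₃, y₃)
  have hp := prime_of_conic hD hD0 hDB hDC hDE hx₁₂.symm hx₂₃ hx₁₃ hy₁₂ hy₁₃ hy₂₃
  have oA : ord (x₁, y₁) D = 0 :=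
    ord_conic_eq_zero hD hp hDB (by simp [hx₁₂.symm]) (Or.inr rfl)
  have oB := ord_conic_eq_one hD hp hDB
  have oC := ord_conic_eq_one hD hp hDC
  have oE := ord_conic_eq_one hD hp hDE
  obtain ⟨e, u, v, o, hr, hs, ho, hb⟩ := exists_residual
    ![(x₁, y₁), (x₂, y₁), (x₁, y₂), (x₃, y₃)]
    (by
      intro i j
      fin_cases i <;> fin_cases j <;>
        simp [hx₁₂, hx₁₃, hx₂₃, hx₁₂.symm, hx₁₃.symm, hx₂₃.symm, hy₁₂, hy₁₃, hy₂₃,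
          hy₁₂.symm, hy₁₃.symm, hy₂₃.symm])
    ![xFiber x₁, xFiber x₃, yFiber y₁, yFiber y₃, D]
    ![1, 1, 0, 0, 1] ![0, 0, 1, 1, 1]
    ![![1, 0, 1, 0, 0], ![0, 0, 1, 0, 1], ![1, 0, 0, 0, 1], ![0, 1, 0, 1, 1]]
    (by simp [Fin.forall_fin_succ, prime_xFiber, prime_yFiber, hp])
    (by simp [Fin.forall_fin_succ, isBihomogeneous_xFiber, isBihomogeneous_yFiber, hD])
    (by
      simp [Fin.forall_fin_succ, ord_xFiber, ord_yFiber, hx₁₂, hx₁₃, hx₁₃.symm,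
        hx₂₃.symm, hy₁₂, hy₁₃, hy₁₃.symm, hy₂₃.symm, oA, oB, oC, oE]) hF0 hF
  simp [Fin.forall_fin_succ, Fin.sum_univ_succ] at hr hs ho hb
  omega

/-- Two points of one row and two further points on other fibres. Besides fibres, the two curves of
bidegree `(1, 1)` through the two further points and one point of the pair are needed. -/
theorem slope_one_pair {x₁ x₂ x₃ x₄ y₁ y₂ y₃ : P1 K} (h₁₂ : x₁ ≠ x₂) (h₁₃ : x₁ ≠ x₃)
    (h₁₄ : x₁ ≠ x₄) (h₂₃ : x₂ ≠ x₃) (h₂₄ : x₂ ≠ x₄) (h₃₄ : x₃ ≠ x₄) (hy₁₂ : y₁ ≠ y₂)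
    (hy₁₃ : y₁ ≠ y₃) (hy₂₃ : y₂ ≠ y₃) {F : CoordRing K} {d k : ℕ} (hF0 : F ≠ 0)
    (hF : IsBihomogeneous F d d) (hA : k ≤ ord (x₁, y₁) F) (hB : k ≤ ord (x₂, y₁) F)
    (hC : k ≤ ord (x₃, y₂) F) (hE : k ≤ ord (x₄, y₃) F) : 6 * k ≤ 5 * d := by
  obtain ⟨D, hD, hD0, hDA, hDC, hDE⟩ := exists_conic (x₁, y₁) (x₃, y₂) (x₄, y₃)
  have hp := prime_of_conic hD hD0 hDA hDC hDE h₁₃ h₁₄ h₃₄ hy₁₂ hy₁₃ hy₂₃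
  have oB : ord (x₂, y₁) D = 0 :=
    ord_conic_eq_zero hD hp hDA (by simp [h₁₂]) (Or.inr rfl)
  have oA := ord_conic_eq_one hD hp hDA
  have oC := ord_conic_eq_one hD hp hDC
  have oE := ord_conic_eq_one hD hp hDE
  obtain ⟨D', hD', hD0', hDB', hDC', hDE'⟩ := exists_conic (x₂, y₁) (x₃, y₂) (x₄, y₃)
  have hp' := prime_of_conic hD' hD0' hDB' hDC' hDE' h₂₃ h₂₄ h₃₄ hy₁₂ hy₁₃ hy₂₃
  have oA' : ord (x₁, y₁) D' = 0 :=
    ord_conic_eq_zero hD' hp' hDB' (by simp [h₁₂.symm]) (Or.inr rfl)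
  have oB' := ord_conic_eq_one hD' hp' hDB'
  have oC' := ord_conic_eq_one hD' hp' hDC'
  have oE' := ord_conic_eq_one hD' hp' hDE'
  obtain ⟨e, u, v, o, hr, hs, ho, hb⟩ := exists_residual
    ![(x₁, y₁), (x₂, y₁), (x₃, y₂), (x₄, y₃)]
    (by
      intro i j
      fin_cases i <;> fin_cases j <;>
        simp [h₁₂, h₁₃, h₁₄, h₂₃, h₂₄, h₃₄, h₁₂.symm, h₁₃.symm, h₁₄.symm, h₂₃.symm, h₂₄.symm,
          h₃₄.symm])
    ![xFiber x₃, xFiber x₄, yFiber y₁, D, D']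
    ![1, 1, 0, 1, 1] ![0, 0, 1, 1, 1]
    ![![0, 0, 1, 1, 0], ![0, 0, 1, 0, 1], ![1, 0, 0, 1, 1], ![0, 1, 0, 1, 1]]
    (by simp [Fin.forall_fin_succ, prime_xFiber, prime_yFiber, hp, hp'])
    (by simp [Fin.forall_fin_succ, isBihomogeneous_xFiber, isBihomogeneous_yFiber, hD, hD'])
    (by
      simp [Fin.forall_fin_succ, ord_xFiber, ord_yFiber, h₁₃.symm, h₁₄.symm, h₂₃.symm, h₂₄.symm,
        h₃₄, h₃₄.symm, hy₁₂, hy₁₃, oA, oB, oC, oE, oA', oB', oC', oE']) hF0 hF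
  simp [Fin.forall_fin_succ, Fin.sum_univ_succ] at hr hs ho hb
  omega

/-- Four points on eight different fibres and on no common curve of bidegree `(1, 1)`. The curves of
bidegree `(1, 1)` through three of the points suffice. -/
theorem slope_general {A B C E : P1 K × P1 K} (hABx : A.1 ≠ B.1) (hACx : A.1 ≠ C.1)
    (hAEx : A.1 ≠ E.1) (hBCx : B.1 ≠ C.1) (hBEx : B.1 ≠ E.1) (hCEx : C.1 ≠ E.1)
    (hABy : A.2 ≠ B.2) (hACy : A.2 ≠ C.2) (hAEy : A.2 ≠ E.2) (hBCy : B.2 ≠ C.2)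
    (hBEy : B.2 ≠ E.2) (hCEy : C.2 ≠ E.2)
    (hconic : ∀ D, IsBihomogeneous D 1 1 → D ≠ 0 → D ∈ pointIdeal A → D ∈ pointIdeal B →
      D ∈ pointIdeal C → D ∉ pointIdeal E)
    {F : CoordRing K} {d k : ℕ} (hF0 : F ≠ 0) (hF : IsBihomogeneous F d d) (hA : k ≤ ord A F)
    (hB : k ≤ ord B F) (hC : k ≤ ord C F) (hE : k ≤ ord E F) : 6 * k ≤ 5 * d := by
  obtain ⟨D₁, hD₁, h0₁, hB₁, hC₁, hE₁⟩ := exists_conic B C E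
  obtain ⟨D₂, hD₂, h0₂, hA₂, hC₂, hE₂⟩ := exists_conic A C E
  obtain ⟨D₃, hD₃, h0₃, hA₃, hB₃, hE₃⟩ := exists_conic A B E
  obtain ⟨D₄, hD₄, h0₄, hA₄, hB₄, hC₄⟩ := exists_conic A B C
  have hp₁ := prime_of_conic hD₁ h0₁ hB₁ hC₁ hE₁ hBCx hBEx hCEx hBCy hBEy hCEy
  have hp₂ := prime_of_conic hD₂ h0₂ hA₂ hC₂ hE₂ hACx hAEx hCEx hACy hAEy hCEy
  have hp₃ := prime_of_conic hD₃ h0₃ hA₃ hB₃ hE₃ hABx hAEx hBEx hABy hAEy hBEy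
  have hp₄ := prime_of_conic hD₄ h0₄ hA₄ hB₄ hC₄ hABx hACx hBCx hABy hACy hBCy
  have o₁ : ord A D₁ = 0 := ord_eq_zero fun h => hconic D₁ hD₁ h0₁ h hB₁ hC₁ hE₁
  have o₂ : ord B D₂ = 0 := ord_eq_zero fun h => hconic D₂ hD₂ h0₂ hA₂ h hC₂ hE₂
  have o₃ : ord C D₃ = 0 := ord_eq_zero fun h => hconic D₃ hD₃ h0₃ hA₃ hB₃ h hE₃
  have o₄ : ord E D₄ = 0 := ord_eq_zero (hconic D₄ hD₄ h0₄ hA₄ hB₄ hC₄)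
  have hne : ∀ {P Q : P1 K × P1 K}, P.1 ≠ Q.1 → P ≠ Q := fun h h' => h (congrArg Prod.fst h')
  obtain ⟨e, u, v, o, hr, hs, ho, hb⟩ := exists_residual ![A, B, C, E]
    (by
      intro i j
      fin_cases i <;> fin_cases j <;>
        simp [hne hABx, hne hACx, hne hAEx, hne hBCx, hne hBEx, hne hCEx, hne hABx.symm,
          hne hACx.symm, hne hAEx.symm, hne hBCx.symm, hne hBEx.symm, hne hCEx.symm])
    ![D₁, D₂, D₃, D₄] ![1, 1, 1, 1] ![1, 1, 1, 1]
    ![![0, 1, 1, 1], ![1, 0, 1, 1], ![1, 1, 0, 1], ![1, 1, 1, 0]]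
    (by simp [Fin.forall_fin_succ, hp₁, hp₂, hp₃, hp₄])
    (by simp [Fin.forall_fin_succ, hD₁, hD₂, hD₃, hD₄])
    (by simp [Fin.forall_fin_succ, ord_conic_eq_one, *]) hF0 hF
  simp [Fin.forall_fin_succ, Fin.sum_univ_succ] at hr hs ho hb
  omega

end Configurations

/-! ### Finite sets of points on no curve of bidegree (1, 1) -/

section Slope

variable {K : Type*} [Field K]

/-- Two points of one row together with two points of different columns off that row, the four
not being the vertices of a rectangle. -/
theorem slope_of_row_pair_aux {x₁ x₂ x₃ x₄ y₁ y₂ y₃ : P1 K} (hx : x₁ ≠ x₂) (hx' : x₃ ≠ x₄)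
    (hy₂ : y₁ ≠ y₂) (hy₃ : y₁ ≠ y₃)
    (hgrid : ¬ (y₂ = y₃ ∧ (x₃ = x₁ ∨ x₃ = x₂) ∧ (x₄ = x₁ ∨ x₄ = x₂)))
    {F : CoordRing K} {d k : ℕ} (hF0 : F ≠ 0) (hF : IsBihomogeneous F d d)
    (hA : k ≤ ord (x₁, y₁) F) (hB : k ≤ ord (x₂, y₁) F) (hC : k ≤ ord (x₃, y₂) F)
    (hE : k ≤ ord (x₄, y₃) F) : 6 * k ≤ 5 * d := by
  by_cases hy : y₂ = y₃
  · subst hy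
    by_cases h₃₁ : x₃ = x₁
    · subst h₃₁
      have h : x₂ ≠ x₄ := fun h => hgrid ⟨rfl, Or.inl rfl, Or.inr h.symm⟩
      exact slope_path_of_two_rows hx.symm h hx' hy₂ hF0 hF hB hA hC hE
    by_cases h₃₂ : x₃ = x₂
    · subst h₃₂
      have h : x₁ ≠ x₄ := fun h => hgrid ⟨rfl, Or.inr rfl, Or.inl h.symm⟩
      exact slope_path_of_two_rows hx h hx' hy₂ hF0 hF hA hB hC hE
    by_cases h₄₁ : x₄ = x₁
    · subst h₄₁
      exact slope_path_of_two_rows hx.symm (Ne.symm h₃₂) (Ne.symm h₃₁) hy₂ hF0 hF hB hA hE hC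
    by_cases h₄₂ : x₄ = x₂
    · subst h₄₂
      exact slope_path_of_two_rows hx (Ne.symm h₃₁) (Ne.symm h₃₂) hy₂ hF0 hF hA hB hE hC
    exact slope_two_pairs hx (Ne.symm h₃₁) (Ne.symm h₄₁) (Ne.symm h₃₂) (Ne.symm h₄₂) hx' hy₂ hF0 hF
      hA hB hC hE
  · by_cases h₃₁ : x₃ = x₁
    · subst h₃₁
      by_cases h₄₂ : x₄ = x₂
      · subst h₄₂
        exact slope_path_of_three_rows hy₂ hy₃ hy hx hF0 hF hA hB hC hE
      · exact slope_corner hx hx' (Ne.symm h₄₂) hy₂ hy₃ hy hF0 hF hA hB hC hE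
    by_cases h₃₂ : x₃ = x₂
    · subst h₃₂
      by_cases h₄₁ : x₄ = x₁
      · subst h₄₁
        exact slope_path_of_three_rows hy₂ hy₃ hy hx.symm hF0 hF hB hA hC hE
      · exact slope_corner hx.symm hx' (Ne.symm h₄₁) hy₂ hy₃ hy hF0 hF hB hA hC hE
    by_cases h₄₁ : x₄ = x₁
    · subst h₄₁
      exact slope_corner hx (Ne.symm h₃₁) (Ne.symm h₃₂) hy₃ hy₂ (Ne.symm hy) hF0 hF hA hB hE hC
    by_cases h₄₂ : x₄ = x₂
    · subst h₄₂
      exact slope_corner hx.symm (Ne.symm h₃₂) (Ne.symm h₃₁) hy₃ hy₂ (Ne.symm hy) hF0 hF hB hA hE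
        hC
    exact slope_one_pair hx (Ne.symm h₃₁) (Ne.symm h₄₁) (Ne.symm h₃₂) (Ne.symm h₄₂) hx' hy₂ hy₃ hy
      hF0 hF hA hB hC hE

/-- If `Z` lies neither on a union of two fibres of different rulings nor in a rectangular grid, a
pair of points of `Z` in one row can be completed to one of the special configurations. -/
theorem slope_of_row_pair {Z : Finset (P1 K × P1 K)}
    (hcross : ∀ x y, ∃ P ∈ Z, P.1 ≠ x ∧ P.2 ≠ y)
    (hgrid : ∀ x₁ x₂ y₁ y₂, ∃ P ∈ Z, (P.1 ≠ x₁ ∧ P.1 ≠ x₂) ∨ (P.2 ≠ y₁ ∧ P.2 ≠ y₂))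
    {x₁ x₂ y₁ : P1 K} (hx : x₁ ≠ x₂) (hA : (x₁, y₁) ∈ Z) (hB : (x₂, y₁) ∈ Z)
    {F : CoordRing K} {d k : ℕ} (hF0 : F ≠ 0) (hF : IsBihomogeneous F d d)
    (hk : ∀ P ∈ Z, k ≤ ord P F) : 6 * k ≤ 5 * d := by
  obtain ⟨⟨x₃, y₂⟩, hC, -, hy₂⟩ := hcross x₁ y₁
  obtain ⟨⟨x₄, y₃⟩, hE, hx', hy₃⟩ := hcross x₃ y₁
  dsimp only at hy₂ hx' hy₃
  by_cases h : y₂ = y₃ ∧ (x₃ = x₁ ∨ x₃ = x₂) ∧ (x₄ = x₁ ∨ x₄ = x₂)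
  · obtain ⟨rfl, h₃, h₄⟩ := h
    -- The four points are the vertices of a rectangle; a fifth point replaces one of them.
    have hCE : (x₁, y₂) ∈ Z ∧ (x₂, y₂) ∈ Z := by
      rcases h₃ with rfl | rfl <;> rcases h₄ with rfl | rfl
      · exact absurd rfl hx'
      · exact ⟨hC, hE⟩
      · exact ⟨hE, hC⟩
      · exact absurd rfl hx'
    obtain ⟨hC', hE'⟩ := hCE
    obtain ⟨⟨x, y⟩, hP, h⟩ := hgrid x₁ x₂ y₁ y₂
    dsimp only at h
    rcases h with ⟨hxx₁, hxx₂⟩ | ⟨hyy₁, hyy₂⟩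
    · by_cases hy : y = y₁
      · subst hy
        refine slope_of_row_pair_aux (Ne.symm hxx₁) hx hy₂.symm hy₂.symm ?_ hF0 hF (hk _ hA)
          (hk _ hP) (hk _ hC') (hk _ hE')
        rintro ⟨-, -, h | h⟩
        · exact hx h.symm
        · exact hxx₂ h.symm
      · refine slope_of_row_pair_aux hx hxx₁ (Ne.symm hy) hy₂.symm ?_ hF0 hF (hk _ hA)
          (hk _ hB) (hk _ hP) (hk _ hC')
        rintro ⟨-, h | h, -⟩
        · exact hxx₁ h
        · exact hxx₂ h
    · by_cases hxx : x = x₁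
      · subst hxx
        exact slope_of_row_pair_aux hx hx (Ne.symm hyy₁) hy₂.symm (fun h => hyy₂ h.1) hF0 hF
          (hk _ hA) (hk _ hB) (hk _ hP) (hk _ hE')
      · exact slope_of_row_pair_aux hx hxx (Ne.symm hyy₁) hy₂.symm (fun h => hyy₂ h.1) hF0 hF
          (hk _ hA) (hk _ hB) (hk _ hP) (hk _ hC')
  · exact slope_of_row_pair_aux hx (Ne.symm hx') (Ne.symm hy₂) (Ne.symm hy₃) h hF0 hF (hk _ hA)
      (hk _ hB) (hk _ hC) (hk _ hE)

/-- The exchange of the two factors of `ℙ¹ × ℙ¹`, on the coordinate ring. -/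
noncomputable def swapEquiv (K : Type*) [Field K] : CoordRing K ≃ₐ[K] CoordRing K :=
  renameEquiv K (Equiv.sumComm (Fin 2) (Fin 2))

theorem swapEquiv_xFiber (p : P1 K) : swapEquiv K (xFiber p) = yFiber p := by
  simp [swapEquiv, xFiber, yFiber]

theorem swapEquiv_yFiber (p : P1 K) : swapEquiv K (yFiber p) = xFiber p := by
  simp [swapEquiv, xFiber, yFiber]

theorem IsBihomogeneous.map_swapEquiv {F : CoordRing K} {a b : ℕ} (hF : IsBihomogeneous F a b) :
    IsBihomogeneous (swapEquiv K F) b a := by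
  rw [F.as_sum, map_sum]
  refine IsWeightedHomogeneous.sum _ _ _ fun d hd => ?_
  have h := hF (mem_support_iff.mp hd)
  rw [weight_biweight, Prod.mk.injEq] at h
  rw [swapEquiv, renameEquiv_apply, rename_monomial]
  refine isWeightedHomogeneous_monomial _ _ _ ?_
  rw [weight_biweight, ← Finsupp.equivMapDomain_eq_mapDomain]
  simp [Finsupp.equivMapDomain_apply, h]

theorem le_ord_swap {P : P1 K × P1 K} {F : CoordRing K} (hF0 : F ≠ 0) {k : ℕ}
    (h : k ≤ ord P F) : k ≤ ord P.swap (swapEquiv K F) := by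
  have hs0 : swapEquiv K F ≠ 0 := (map_ne_zero_iff _ (swapEquiv K).injective).mpr hF0
  rw [← mem_pointIdeal_pow_iff P hF0] at h
  rw [← mem_pointIdeal_pow_iff _ hs0]
  have h1 : (pointIdeal P).map (swapEquiv K) ≤ pointIdeal P.swap := by
    rw [pointIdeal_eq P, Ideal.map_span, Ideal.span_le]
    rintro _ ⟨G, rfl | rfl, rfl⟩
    · exact swapEquiv_xFiber P.1 ▸ yFiber_mem P.swap
    · exact swapEquiv_yFiber P.2 ▸ xFiber_mem P.swap
  have h2 := Ideal.mem_map_of_mem (swapEquiv K) h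
  rw [Ideal.map_pow] at h2
  exact Ideal.pow_right_mono h1 k h2

/-- If `Z` lies neither on a curve of bidegree `(1, 1)` nor in a rectangular grid of four points,
then forms of bidegree `(d, d)` with multiplicity `k` along `Z` satisfy `d ≥ 6 k / 5`. -/
theorem slope_of_not_on_conic {Z : Finset (P1 K × P1 K)}
    (hconic : ∀ D, IsBihomogeneous D 1 1 → D ≠ 0 → ∃ P ∈ Z, D ∉ pointIdeal P)
    (hgrid : ∀ x₁ x₂ y₁ y₂, ∃ P ∈ Z, (P.1 ≠ x₁ ∧ P.1 ≠ x₂) ∨ (P.2 ≠ y₁ ∧ P.2 ≠ y₂))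
    {F : CoordRing K} {d k : ℕ} (hF0 : F ≠ 0) (hF : IsBihomogeneous F d d)
    (hk : ∀ P ∈ Z, k ≤ ord P F) : 6 * k ≤ 5 * d := by
  classical
  have hcross : ∀ x y, ∃ P ∈ Z, P.1 ≠ x ∧ P.2 ≠ y := by
    intro x y
    obtain ⟨P, hP, h⟩ := hconic (xFiber x * yFiber y)
      ((isBihomogeneous_xFiber x).mul (isBihomogeneous_yFiber y))
      (mul_ne_zero (xFiber_ne_zero x) (yFiber_ne_zero y))
    refine ⟨P, hP, ?_, ?_⟩
    · rintro rfl
      exact h (Ideal.mul_mem_right _ _ (xFiber_mem P))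
    · rintro rfl
      exact h (Ideal.mul_mem_left _ _ (yFiber_mem P))
  by_cases hrow : ∃ P ∈ Z, ∃ Q ∈ Z, P ≠ Q ∧ P.2 = Q.2
  · obtain ⟨⟨x₁, y₁⟩, hP, ⟨x₂, y₂⟩, hQ, hne, rfl⟩ := hrow
    exact slope_of_row_pair hcross hgrid (fun h => hne (Prod.ext h rfl)) hP hQ hF0 hF hk
  by_cases hcol : ∃ P ∈ Z, ∃ Q ∈ Z, P ≠ Q ∧ P.1 = Q.1
  · obtain ⟨⟨x₁, y₁⟩, hP, ⟨x₂, y₂⟩, hQ, hne, rfl⟩ := hcol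
    refine slope_of_row_pair (Z := Z.image Prod.swap) (x₁ := y₁) (x₂ := y₂) ?_ ?_
      (fun h => hne (Prod.ext rfl h)) (Finset.mem_image_of_mem Prod.swap hP)
      (Finset.mem_image_of_mem Prod.swap hQ)
      ((map_ne_zero_iff _ (swapEquiv K).injective).mpr hF0) hF.map_swapEquiv ?_
    · intro x y
      obtain ⟨P, hP, h⟩ := hcross y x
      exact ⟨P.swap, Finset.mem_image_of_mem _ hP, h.2, h.1⟩
    · intro x₁ x₂ y₁ y₂
      obtain ⟨P, hP, h⟩ := hgrid y₁ y₂ x₁ x₂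
      exact ⟨P.swap, Finset.mem_image_of_mem _ hP, h.symm⟩
    · intro P hP
      obtain ⟨Q, hQ, rfl⟩ := Finset.mem_image.mp hP
      exact le_ord_swap hF0 (hk Q hQ)
  -- No two points of `Z` lie on a common fibre.
  have hy : ∀ {P Q}, P ∈ Z → Q ∈ Z → P ≠ Q → P.2 ≠ Q.2 := fun hP hQ hne h =>
    hrow ⟨_, hP, _, hQ, hne, h⟩
  have hx : ∀ {P Q}, P ∈ Z → Q ∈ Z → P ≠ Q → P.1 ≠ Q.1 := fun hP hQ hne h =>
    hcol ⟨_, hP, _, hQ, hne, h⟩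
  obtain ⟨A, hA, -⟩ := hconic _ ((isBihomogeneous_X_inl 0).mul (isBihomogeneous_X_inr 0))
    (mul_ne_zero (X_ne_zero _) (X_ne_zero _))
  obtain ⟨D₁, hD₁, h0₁, hA₁, -, -⟩ := exists_conic A A A
  obtain ⟨B, hB, hB₁⟩ := hconic D₁ hD₁ h0₁
  have hAB : A ≠ B := fun h => hB₁ (h ▸ hA₁)
  obtain ⟨D₂, hD₂, h0₂, hA₂, hB₂, -⟩ := exists_conic A B B
  obtain ⟨C, hC, hC₂⟩ := hconic D₂ hD₂ h0₂
  have hAC : A ≠ C := fun h => hC₂ (h ▸ hA₂)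
  have hBC : B ≠ C := fun h => hC₂ (h ▸ hB₂)
  obtain ⟨D₃, hD₃, h0₃, hA₃, hB₃, hC₃⟩ := exists_conic A B C
  obtain ⟨E, hE, hE₃⟩ := hconic D₃ hD₃ h0₃
  have hAE : A ≠ E := fun h => hE₃ (h ▸ hA₃)
  have hBE : B ≠ E := fun h => hE₃ (h ▸ hB₃)
  have hCE : C ≠ E := fun h => hE₃ (h ▸ hC₃)
  refine slope_general (hx hA hB hAB) (hx hA hC hAC) (hx hA hE hAE) (hx hB hC hBC) (hx hB hE hBE)
    (hx hC hE hCE) (hy hA hB hAB) (hy hA hC hAC) (hy hA hE hAE) (hy hB hC hBC) (hy hB hE hBE)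
    (hy hC hE hCE) ?_ hF0 hF (hk A hA) (hk B hB) (hk C hC) (hk E hE)
  intro D hD hD0 hAD hBD hCD hED
  have hp := prime_of_conic hD hD0 hAD hBD hCD (hx hA hB hAB) (hx hA hC hAC) (hx hB hC hBC)
    (hy hA hB hAB) (hy hA hC hAC) (hy hB hC hBC)
  obtain ⟨G, rfl⟩ := conic_unique hD hp hD₃ h0₃ hAB hAC hBC hAD hBD hCD hA₃ hB₃ hC₃
  exact hE₃ (Ideal.mul_mem_right _ _ hED)

end Slope

/-! ### Initial degrees of symbolic powers -/

section InitialDegree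

variable {K : Type*} [Field K]

theorem alphaStar_le {J : Ideal (CoordRing K)} {F : CoordRing K} {k : ℕ} (hF : F ∈ J)
    (hF0 : F ≠ 0) (hk : IsBihomogeneous F k k) : alphaStar J ≤ k :=
  Nat.sInf_le ⟨F, hF, hF0, hk⟩

/-- The infimum defining `alphaStar` is attained for symbolic powers of ideals of points. -/
theorem exists_alphaStar_form (Z : Finset (P1 K × P1 K)) (m : ℕ) :
    ∃ F ∈ symbolicPower (pointsIdeal Z) m, F ≠ 0 ∧
      IsBihomogeneous F (alphaStar (symbolicPower (pointsIdeal Z) m))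
        (alphaStar (symbolicPower (pointsIdeal Z) m)) := by
  have hne : {k : ℕ | ∃ F ∈ symbolicPower (pointsIdeal Z) m, F ≠ 0 ∧
      IsBihomogeneous F k k}.Nonempty := by
    refine ⟨∑ P ∈ Z, m, ∏ P ∈ Z, (xFiber P.1 * yFiber P.2) ^ m, ?_, ?_, ?_⟩
    · rw [mem_symbolicPower_pointsIdeal]
      intro P hP
      exact Ideal.mem_of_dvd _
        (Finset.dvd_prod_of_mem (fun P : P1 K × P1 K => (xFiber P.1 * yFiber P.2) ^ m) hP)
        (Ideal.pow_mem_pow (Ideal.mul_mem_right _ _ (xFiber_mem P)) m)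
    · exact Finset.prod_ne_zero_iff.mpr fun P _ =>
        pow_ne_zero _ (mul_ne_zero (xFiber_ne_zero _) (yFiber_ne_zero _))
    · refine IsBihomogeneous.prod _ _ _ _ fun P _ => ?_
      simpa using ((isBihomogeneous_xFiber P.1).mul (isBihomogeneous_yFiber P.2)).pow m
  exact Nat.sInf_mem hne

theorem liesOnDivisor_of_mem {Z : Finset (P1 K × P1 K)} {F : CoordRing K} {a b : ℕ}
    (hF : IsBihomogeneous F a b) (hF0 : F ≠ 0) (h : F ∈ pointsIdeal Z) : LiesOnDivisor Z a b :=
  ⟨F, hF0, hF, fun P hP => (hF.mem_pointIdeal_iff P).mp (mem_pointsIdeal.mp h P hP)⟩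

/-- Let `a` be the initial degree of the ideal of `Z`, so that some form of bidegree
`(a + 5, a + 5)` has multiplicity `6` along `Z`. If `a ≥ 3`, then `6 a² ≤ 2 a (a + 5)` fails; if
`a = 2`, then `6 · 6 ≤ 5 · 7` fails. -/
theorem alphaStar_pointsIdeal_eq_one {Z : Finset (P1 K × P1 K)}
    (h : ∀ k ∈ Finset.Icc 1 5, alphaStar (symbolicPower (pointsIdeal Z) (k + 1)) =
      alphaStar (symbolicPower (pointsIdeal Z) k) + 1) : alphaStar (pointsIdeal Z) = 1 := by
  have h1 := h 1 (by decide)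
  have h2 := h 2 (by decide)
  have h3 := h 3 (by decide)
  have h4 := h 4 (by decide)
  have h5 := h 5 (by decide)
  norm_num at h1 h2 h3 h4 h5
  obtain ⟨F₁, hF₁, h0₁, hdeg₁⟩ := exists_alphaStar_form Z 1
  obtain ⟨F₆, hF₆, h0₆, hdeg₆⟩ := exists_alphaStar_form Z 6
  rw [mem_symbolicPower_iff_ord h0₆] at hF₆
  rw [symbolicPower_pointsIdeal_one] at h1 hF₁ hdeg₁
  obtain ⟨a, ha⟩ : ∃ a, alphaStar (pointsIdeal Z) = a := ⟨_, rfl⟩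
  rw [ha] at h1 hdeg₁ ⊢
  rw [show alphaStar (symbolicPower (pointsIdeal Z) 6) = a + 5 by omega] at hdeg₆
  by_contra hne
  have hcases : a = 0 ∨ a = 2 ∨ 3 ≤ a := by omega
  rcases hcases with rfl | rfl | ha3
  · -- A nonzero constant vanishes at no point.
    have hZ : Z = ∅ := by
      refine Finset.eq_empty_of_forall_notMem fun P hP => (isPrime_pointIdeal P).ne_top ?_
      exact Ideal.eq_top_of_isUnit_mem _ (mem_pointsIdeal.mp hF₁ P hP)
        (isUnit_of_isBihomogeneous_zero h0₁ hdeg₁)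
    have h0 : (1 : CoordRing K) ∈ symbolicPower (pointsIdeal Z) 2 :=
      mem_symbolicPower_pointsIdeal.mpr (by simp [hZ])
    have := alphaStar_le h0 one_ne_zero isBihomogeneous_one
    omega
  · have hslope := slope_of_not_on_conic (Z := Z) ?_ ?_ h0₆ hdeg₆ hF₆
    · omega
    · intro D hD hD0
      by_contra! hmem
      have := alphaStar_le (mem_pointsIdeal.mpr hmem) hD0 hD
      omega
    · -- The points of a rectangular grid are double points of the union of the four fibres.
      intro x₁ x₂ y₁ y₂
      by_contra! hmem
      have hdeg := ((isBihomogeneous_xFiber x₁).mul (isBihomogeneous_xFiber x₂)).mul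
        ((isBihomogeneous_yFiber y₁).mul (isBihomogeneous_yFiber y₂))
      have h0 : xFiber x₁ * xFiber x₂ * (yFiber y₁ * yFiber y₂) ≠ 0 :=
        mul_ne_zero (mul_ne_zero (xFiber_ne_zero _) (xFiber_ne_zero _))
          (mul_ne_zero (yFiber_ne_zero _) (yFiber_ne_zero _))
      have hJ : xFiber x₁ * xFiber x₂ * (yFiber y₁ * yFiber y₂) ∈
          symbolicPower (pointsIdeal Z) 2 := by
        rw [mem_symbolicPower_pointsIdeal]
        intro P hP
        obtain ⟨hx, hy⟩ := hmem P hP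
        rw [pow_two]
        refine Ideal.mul_mem_mul ?_ ?_
        · by_cases hx₁ : P.1 = x₁
          · exact Ideal.mul_mem_right _ _ (hx₁ ▸ xFiber_mem P)
          · exact Ideal.mul_mem_left _ _ (hx hx₁ ▸ xFiber_mem P)
        · by_cases hy₁ : P.2 = y₁
          · exact Ideal.mul_mem_right _ _ (hy₁ ▸ yFiber_mem P)
          · exact Ideal.mul_mem_left _ _ (hy hy₁ ▸ yFiber_mem P)
      have := alphaStar_le hJ h0 hdeg
      omega
  · obtain ⟨b, rfl⟩ : ∃ b, a = b + 1 := ⟨a - 1, by omega⟩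
    have hdet : Determines Z b := by
      intro F hF hFZ
      by_contra hF0
      have := alphaStar_le hFZ hF0 hF
      omega
    obtain ⟨Y, hYZ, hcard, hbound⟩ := hdet.exists_sum_ord_le
    have h6 := hbound F₆ _ _ h0₆ hdeg₆
    have h7 : Y.card * 6 ≤ ∑ P ∈ Y, ord P F₆ := by
      rw [← smul_eq_mul]
      exact Finset.card_nsmul_le_sum _ _ _ fun P hP => hF₆ P (hYZ hP)
    nlinarith

/-- Over every field `ℙ¹` has at least the three rational points `0`, `1` and `∞`. -/
theorem exists_three_points (K : Type*) [Field K] : ∃ p q r : P1 K, p ≠ q ∧ p ≠ r ∧ q ≠ r := by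
  have h1 : (![1, 0] : Fin 2 → K) ≠ 0 := fun h => one_ne_zero (congrFun h 0)
  have h2 : (![0, 1] : Fin 2 → K) ≠ 0 := fun h => one_ne_zero (congrFun h 1)
  have h3 : (![1, 1] : Fin 2 → K) ≠ 0 := fun h => one_ne_zero (congrFun h 0)
  refine ⟨Projectivization.mk K _ h1, Projectivization.mk K _ h2, Projectivization.mk K _ h3,
    ?_, ?_, ?_⟩
  · rw [Ne, Projectivization.mk_eq_mk_iff']
    rintro ⟨c, hc⟩
    simpa using congrFun hc 0
  · rw [Ne, Projectivization.mk_eq_mk_iff']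
    rintro ⟨c, hc⟩
    have h4 := congrFun hc 0
    have h5 := congrFun hc 1
    simp at h4 h5
    simp [h4] at h5
  · rw [Ne, Projectivization.mk_eq_mk_iff']
    rintro ⟨c, hc⟩
    have h4 := congrFun hc 0
    have h5 := congrFun hc 1
    simp at h4 h5
    simp [h4] at h5

open Classical in
/-- Four points forming a path of three columns and two rows. -/
noncomputable def pathPoints (x₁ x₂ x₃ y₁ y₂ : P1 K) : Finset (P1 K × P1 K) :=
  {(x₁, y₁), (x₂, y₁), (x₂, y₂), (x₃, y₂)}

theorem forall_mem_pathPoints {x₁ x₂ x₃ y₁ y₂ : P1 K} {p : P1 K × P1 K → Prop} :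
    (∀ P ∈ pathPoints x₁ x₂ x₃ y₁ y₂, p P) ↔
      p (x₁, y₁) ∧ p (x₂, y₁) ∧ p (x₂, y₂) ∧ p (x₃, y₂) := by
  simp [pathPoints]

/-- A weighted union of the fibres through the four points, of multiplicity `m` at each of them. -/
theorem alphaStar_pathPoints_le {x₁ x₂ x₃ y₁ y₂ : P1 K} {m n : ℕ} (v₁ v₂ v₃ h₁ h₂ : ℕ)
    (hv : v₁ + v₂ + v₃ = n) (hh : h₁ + h₂ = n) (hA : m ≤ v₁ + h₁) (hB : m ≤ v₂ + h₁)
    (hC : m ≤ v₂ + h₂) (hE : m ≤ v₃ + h₂) :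
    alphaStar (symbolicPower (pointsIdeal (pathPoints x₁ x₂ x₃ y₁ y₂)) m) ≤ n := by
  have hmem : ∀ {x y : P1 K} {v h : ℕ} (G : CoordRing K), m ≤ v + h →
      xFiber x ^ v * yFiber y ^ h ∣ G → G ∈ pointIdeal (x, y) ^ m := by
    intro x y v h G hm hdvd
    refine Ideal.mem_of_dvd _ hdvd (Ideal.pow_le_pow_right hm ?_)
    rw [pow_add]
    exact Ideal.mul_mem_mul (Ideal.pow_mem_pow (xFiber_mem (x, y)) _)
      (Ideal.pow_mem_pow (yFiber_mem (x, y)) _)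
  have hx := fun {x : P1 K} v => (isBihomogeneous_xFiber x).pow v
  have hy := fun {y : P1 K} h => (isBihomogeneous_yFiber y).pow h
  have hx0 := fun {x : P1 K} v => pow_ne_zero v (xFiber_ne_zero x)
  have hy0 := fun {y : P1 K} h => pow_ne_zero h (yFiber_ne_zero y)
  refine alphaStar_le (F := (xFiber x₁ ^ v₁ * xFiber x₂ ^ v₂ * xFiber x₃ ^ v₃) *
    (yFiber y₁ ^ h₁ * yFiber y₂ ^ h₂)) ?_ ?_ ?_
  · rw [mem_symbolicPower_pointsIdeal, forall_mem_pathPoints]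
    refine ⟨hmem _ hA ?_, hmem _ hB ?_, hmem _ hC ?_, hmem _ hE ?_⟩
    · exact mul_dvd_mul (dvd_mul_of_dvd_left (dvd_mul_right _ _) _) (dvd_mul_right _ _)
    · exact mul_dvd_mul (dvd_mul_of_dvd_left (dvd_mul_left _ _) _) (dvd_mul_right _ _)
    · exact mul_dvd_mul (dvd_mul_of_dvd_left (dvd_mul_left _ _) _) (dvd_mul_left _ _)
    · exact mul_dvd_mul (dvd_mul_left _ _) (dvd_mul_left _ _)
  · exact mul_ne_zero (mul_ne_zero (mul_ne_zero (hx0 _) (hx0 _)) (hx0 _))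
      (mul_ne_zero (hy0 _) (hy0 _))
  · have h := (((hx (x := x₁) v₁).mul (hx (x := x₂) v₂)).mul (hx (x := x₃) v₃)).mul
      ((hy (y := y₁) h₁).mul (hy (y := y₂) h₂))
    convert h using 1 <;> omega

/-- The upper bounds come from weighted unions of fibres, the lower bounds from the slope `6 / 5`. -/
theorem alphaStar_pathPoints {x₁ x₂ x₃ y₁ y₂ : P1 K} (h₁₂ : x₁ ≠ x₂) (h₁₃ : x₁ ≠ x₃)
    (h₂₃ : x₂ ≠ x₃) (hy : y₁ ≠ y₂) {m : ℕ} (hm : m ∈ Finset.Icc 1 5) :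
    alphaStar (symbolicPower (pointsIdeal (pathPoints x₁ x₂ x₃ y₁ y₂)) m) = m + 1 := by
  rw [Finset.mem_Icc] at hm
  refine le_antisymm ?_ ?_
  · obtain rfl | rfl | rfl | rfl | rfl : m = 1 ∨ m = 2 ∨ m = 3 ∨ m = 4 ∨ m = 5 := by omega
    · exact alphaStar_pathPoints_le 2 0 0 1 1 rfl rfl (by decide) (by decide) (by decide)
        (by decide)
    · exact alphaStar_pathPoints_le 1 1 1 2 1 rfl rfl (by decide) (by decide) (by decide)
        (by decide)
    · exact alphaStar_pathPoints_le 2 1 1 2 2 rfl rfl (by decide) (by decide) (by decide)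
        (by decide)
    · exact alphaStar_pathPoints_le 1 2 2 3 2 rfl rfl (by decide) (by decide) (by decide)
        (by decide)
    · exact alphaStar_pathPoints_le 2 2 2 3 3 rfl rfl (by decide) (by decide) (by decide)
        (by decide)
  · obtain ⟨F, hF, hF0, hdeg⟩ := exists_alphaStar_form (pathPoints x₁ x₂ x₃ y₁ y₂) m
    rw [mem_symbolicPower_iff_ord hF0, forall_mem_pathPoints] at hF
    obtain ⟨hA, hB, hC, hE⟩ := hF
    have := slope_path_of_two_rows h₁₂ h₁₃ h₂₃ hy hF0 hdeg hA hB hC hE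
    omega

theorem not_liesOnDivisor_pathPoints {x₁ x₂ x₃ y₁ y₂ : P1 K} (h₁₂ : x₁ ≠ x₂) (h₁₃ : x₁ ≠ x₃)
    (h₂₃ : x₂ ≠ x₃) (hy : y₁ ≠ y₂) : ¬ LiesOnDivisor (pathPoints x₁ x₂ x₃ y₁ y₂) 1 1 := by
  rintro ⟨F, hF0, hF, h⟩
  have h1 : ∀ P ∈ pathPoints x₁ x₂ x₃ y₁ y₂, 1 ≤ ord P F := fun P hP =>
    (mem_pointIdeal_iff_ord P hF0).mp ((hF.mem_pointIdeal_iff P).mpr (h P hP))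
  obtain ⟨hA, hB, hC, hE⟩ := forall_mem_pathPoints.mp h1
  have := slope_path_of_two_rows h₁₂ h₁₃ h₂₃ hy hF0 hF hA hB hC hE
  omega

end InitialDegree

end FatPoints

theorem mainTheorem2 (K : Type*) [Field K] :
    (∀ Z : Finset (FatPoints.P1 K × FatPoints.P1 K),
      (∀ k ∈ Finset.Icc 1 5,
        FatPoints.alphaStar (FatPoints.symbolicPower (FatPoints.pointsIdeal Z) (k + 1)) =
          FatPoints.alphaStar (FatPoints.symbolicPower (FatPoints.pointsIdeal Z) k) + 1) →
      FatPoints.alphaStar (FatPoints.pointsIdeal Z) = 1 ∧ FatPoints.LiesOnDivisor Z 1 1) ∧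
    (∃ Z : Finset (FatPoints.P1 K × FatPoints.P1 K),
      (∀ k ∈ Finset.Icc 1 4,
        FatPoints.alphaStar (FatPoints.symbolicPower (FatPoints.pointsIdeal Z) (k + 1)) =
          FatPoints.alphaStar (FatPoints.symbolicPower (FatPoints.pointsIdeal Z) k) + 1) ∧
      FatPoints.alphaStar (FatPoints.pointsIdeal Z) = 2 ∧ ¬ FatPoints.LiesOnDivisor Z 1 1) := by
  refine ⟨fun Z h => ?_, ?_⟩
  · have h1 := FatPoints.alphaStar_pointsIdeal_eq_one h
    obtain ⟨F, hF, hF0, hdeg⟩ := FatPoints.exists_alphaStar_form Z 1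
    rw [FatPoints.symbolicPower_pointsIdeal_one] at hF hdeg
    rw [h1] at hdeg
    exact ⟨h1, FatPoints.liesOnDivisor_of_mem hdeg hF0 hF⟩
  · obtain ⟨p, q, r, hpq, hpr, hqr⟩ := FatPoints.exists_three_points K
    have hα := fun {m} => FatPoints.alphaStar_pathPoints hpq hpr hqr hpq (m := m)
    refine ⟨FatPoints.pathPoints p q r p q, fun k hk => ?_, ?_,
      FatPoints.not_liesOnDivisor_pathPoints hpq hpr hqr hpq⟩
    · rw [Finset.mem_Icc] at hk
      rw [hα (Finset.mem_Icc.mpr ⟨by omega, by omega⟩),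
        hα (Finset.mem_Icc.mpr ⟨by omega, by omega⟩)]
    · rw [← FatPoints.symbolicPower_pointsIdeal_one]
      exact hα (by decide)
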